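/- **Setting.** Let $\mathrm{FIN}_+$ be the category whose objects are the $\bullet^n$ with $n\ge 1$ and whose maps $\bullet^n\to\bullet^m$ are the functions $\{0,\dots,m-1\}\to\{0,\dots,n-1\}$. A *world* is a pair $\mathbf W=(\bullet^n,\partial)$ with $\partial:\{0,\dots,n-1\}\to\mathbb N$ (the time left on each clock); a map $(V,\partial_V)\to(U,\partial_U)$ is a map $f:V\to U$ of $\mathrm{FIN}_+$ with $\partial_V(f(\kappa))\le\partial_U(\kappa)$ for all clocks $\kappa$ of $U$. Let $\mathbb S$ be the topos of presheaves on worlds, with the object $\mathbb K$ of clock names, $\mathbb K(\mathbf W)=\{0,\dots,n-1\}$. All notions below are in the internal logic of $\mathbb S$ (Kripke–Joyal forcing). For a clock $\kappa$ and a proposition $\phi$, $\mathbf U\Vdash\triangleright_\kappa\phi$ holds iff $\partial_U(\kappa)=0$, or $\partial_U(\kappa)=m+1$ and $\mathbf U[\kappa\mapsto m]\Vdash\phi$. **Programs.** The object $\mathrm{Tm}_n$ of programs with $n$ free variables is inductively defined in $\mathbb S$ by variables, $\lambda x.M$, $\lambda\kappa.M$, $M\,N$, $M\,\kappa$, $\langle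 M,N\rangle$, $M.1$, $M.2$, $\mathsf{fix}\,x.M$, $\star$, $\mathsf{tt}$, $\mathsf{ff}$, $\mathsf{if}$, $\mathsf{ze}$, $\mathsf{su}(M)$, $\mathsf{ifze}$, $\mathsf{sup}(M,x.N)$, $\mathsf{wrec}(M,xyz.N)$, and the types $(x:A)\to B$, $(x:A)\times B$, $(\mathsf W x:A)B$, $\mathsf{Eq}_A(M,N)$, $\prod_\kappa A$, $\bigcap_\kappa A$, $\triangleright_\kappa A$, $\mathsf{void}$, $\mathsf{unit}$, $\mathsf{bool}$, $\mathsf{nat}$, $\mathcal U_i$ ($i\in\mathbb N$); bound clocks are represented by the exponential $\mathrm{Tm}_n^{\mathbb K}$. Closed programs have the call-by-name small-step semantics $\mapsto$ with lazy constructors, in which $\mathsf{fix}\,x.M\mapsto M[\mathsf{fix}\,x.M/x]$; values are the introduction forms and the type formers. Formal terms $M,A$ are built by the same grammar from formal clock variables $\Delta$ and term variables; given $\varrho\in\mathbb K^{\Delta}$, a formal term $M$ with $n$ free variables elaborates to a program $[\![M]\!]\varrho\in\mathrm{Tm}_n$, and a context $\Gamma=x_1:A_1,\dots,x_n:A_n$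 to a telescope $[\![\Gamma]\!]\varrho$. **Types.** A candidate type system is a subobject $\tau$ of $\mathrm{Tm}_0\times\mathcal P(\mathrm{Tm}_0\times\mathrm{Tm}_0)$. For such $\sigma$ let $\overline\sigma$ be the least $\tau$ that contains $\sigma$ and is closed under evaluation of types to values and under the connectives other than universes, each with its usual meaning as a relation on closed programs (functions and pairs are compared by application and by projections; $\mathsf{void}$ is empty; the other data types and equality types are closed under evaluation of their elements). In particular: if $\triangleright_\kappa\big((A,\mathcal A)\in\tau\big)$, then $\triangleright_\kappa A$ is a type with relation $\{(M_0,M_1)\mid\triangleright_\kappa((M_0,M_1)\in\mathcal A)\}$; if $(A(\kappa),\mathcal A(\kappa))\in\tau$ for all $\kappa:\mathbb K$, then $\bigcap_\kappa A(\kappa)$ is a type with relation $\bigcap_\kappa\mathcal A(\kappa)$, and $\prod_\kappa A(\kappa)$ is a type with relation $\{(M_0,M_1)\mid\forall\kappa.\,(M_0\,\kappa,M_1\,\kappa)\in\mathcal A(\kappa)\}$. Let $\tau_n=\overline{\nu_n}$, where $\nu_n$ contains exactly the programs that evaluate to some $\mathcal U_i$ with $i<n$, with the relation $\{(A_0,A_1)\mid\exists\mathcal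 A.\,(A_0,\mathcal A),(A_1,\mathcal A)\in\tau_i\}$; let $\tau_\omega=\bigcup_n\tau_n$. Write $A\sim B$ if $(A,\mathcal A),(B,\mathcal A)\in\tau_\omega$ for some $\mathcal A$, and $M_0\sim M_1\in A$ if $(A,\mathcal A)\in\tau_\omega$ and $(M_0,M_1)\in\mathcal A$ for some $\mathcal A$. Instantiations $\gamma_0,\gamma_1$ of a telescope are similar if they are componentwise similar at the types instantiated by $\gamma_0$. A telescope is a *context* if each of its types $B$ is functional over the preceding ones, i.e. $B[\gamma_0]\sim B[\gamma_1]$ for all similar $\gamma_0,\gamma_1$. **Judgments.** $\Delta\mid\Gamma\gg M_0=M_1\in A$ is the proposition of $\mathbb S$: for all $\varrho\in\mathbb K^\Delta$, if $[\![\Gamma]\!]\varrho$ is a context and $[\![A]\!]\varrho$ is functional over it, then $[\![M_0]\!]\varrho[\gamma_0]\sim[\![M_1]\!]\varrho[\gamma_1]\in[\![A]\!]\varrho[\gamma_0]$ for all similar instantiations $\gamma_0,\gamma_1$ of $[\![\Gamma]\!]\varrho$. Write $M\in A$ for $M=M\in A$, and $A\to B$ for $(x:A)\to B$ with $x$ not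 free in $B$. **Theorem.** Let $\Delta,k$ be a clock context, let $\Gamma$ be a typing context and $A$ a formal term over $\Delta,k$ and the variables of $\Gamma$. 1. For all formal terms $M_0,M_1$ over $\Delta,k$ and the variables of $\Gamma,x$, the following implication holds in the internal logic of $\mathbb S$, i.e. at every world: $$\big(\Delta,k\mid\Gamma,\,x:\triangleright_kA\gg M_0=M_1\in A\big)\ \Longrightarrow\ \big(\Delta,k\mid\Gamma\gg\mathsf{fix}\,x.M_0=\mathsf{fix}\,x.M_1\in A\big).$$ 2. The judgment $\Delta,k\mid\Gamma\gg\lambda f.\,\mathsf{fix}\,x.\,f\,x\in(\triangleright_kA\to A)\to A$ holds at every world. -/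

import Mathlib

open CategoryTheory

namespace GCTT

/-! ## Worlds: the base category of clock contexts with times -/

/-- A world: a finite non-empty set of clock names (numbered `0, …, card - 1`), together with the
amount of time that is left on each of them. -/
structure World where
  card : ℕ
  pos : 0 < card
  time : Fin card → ℕ

/-- A morphism `V ⟶ U` of worlds: a map of non-empty finite cardinals from the clocks of `U` to the
clocks of `V`, along which time can only decrease. -/
@[ext]
structure World.Hom (V U : World) where
  fn : Fin U.card → Fin V.card
  le : ∀ κ, V.time (fn κ) ≤ U.time κ

instance : Category World where
  Hom := World.Hom
  id U := ⟨id, fun _ => le_rfl⟩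
  comp f g := ⟨f.fn ∘ g.fn, fun κ => (f.le _).trans (g.le κ)⟩

/-- The presheaf of clock names; a morphism `f : V ⟶ W` acts by `f.fn`. -/
abbrev Clk (W : World) : Type := Fin W.card

theorem World.Hom.le_time {V W : World} (f : V ⟶ W) (κ : Clk W) :
    V.time (f.fn κ) ≤ W.time κ := World.Hom.le f κ

@[simp] theorem World.id_fn (W : World) : World.Hom.fn (𝟙 W) = id := rfl

@[simp] theorem World.comp_fn {U V W : World} (f : U ⟶ V) (g : V ⟶ W) :
    World.Hom.fn (f ≫ g) = f.fn ∘ g.fn := rfl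

theorem World.hom_ext {V W : World} {f g : V ⟶ W} (h : f.fn = g.fn) : f = g := World.Hom.ext h

/-- The world `W[κ ↦ m]`. -/
def World.set (W : World) (κ : Clk W) (m : ℕ) : World where
  card := W.card
  pos := W.pos
  time := Function.update W.time κ m

/-- The map `[κ += 1] : W[κ ↦ m] ⟶ W`, when `κ` has time `m + 1` at `W`. -/
def tick {W : World} (κ : Clk W) (m : ℕ) (h : W.time κ = m + 1) : W.set κ m ⟶ W where
  fn := id
  le j := by
    by_cases hj : j = κ
    · subst hj; simp [World.set, h]
    · simp [World.set, hj]

/-- The forcing clause of the later modality at the world `W`, for a proposition `φ` that is given by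
its truth values at all worlds over `W`: true if no time is left on `κ`, and otherwise true if `φ`
is true after one tick of `κ`. -/
def Later {W : World} (κ : Clk W) (φ : ∀ {V : World}, (V ⟶ W) → Prop) : Prop :=
  ∀ (m : ℕ) (h : W.time κ = m + 1), φ (tick κ m h)

/-- The extension of an environment by a value for the newest variable, which has index `0`. -/
def ext {α : Type} {n : ℕ} (γ : Fin n → α) (a : α) : Fin (n + 1) → α := Fin.cases a γ

@[simp] theorem ext_zero {α : Type} {n : ℕ} (γ : Fin n → α) (a : α) : ext γ a 0 = a := rfl

@[simp] theorem ext_succ {α : Type} {n : ℕ} (γ : Fin n → α) (a : α) (i : Fin n) :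
    ext γ a i.succ = γ i := rfl

theorem comp_ext {α β : Type} {n : ℕ} (f : α → β) (γ : Fin n → α) (a : α) :
    f ∘ ext γ a = ext (f ∘ γ) (f a) := by
  funext i; induction i using Fin.cases <;> rfl

/-- The extension of a map between finite sets of names to a newly bound name. -/
def lift {m n : ℕ} (f : Fin n → Fin m) : Fin (n + 1) → Fin (m + 1) := ext (Fin.succ ∘ f) 0

@[simp] theorem lift_zero {m n : ℕ} (f : Fin n → Fin m) : lift f 0 = 0 := rfl

@[simp] theorem lift_succ {m n : ℕ} (f : Fin n → Fin m) (i : Fin n) :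
    lift f i.succ = (f i).succ := rfl

@[simp] theorem lift_id (n : ℕ) : lift (id : Fin n → Fin n) = id := by
  funext i; induction i using Fin.cases <;> rfl

theorem lift_comp {l m n : ℕ} (f : Fin m → Fin l) (g : Fin n → Fin m) :
    lift f ∘ lift g = lift (f ∘ g) := by
  funext i; induction i using Fin.cases <;> rfl

/-! ## Formal terms -/

/-- Formal terms with `Δ` clock variables and `n` term variables, up to renaming of bound variables.
Clock variables and term variables are de Bruijn indices; the most recently bound one is `0`. -/
inductive Fm : ℕ → ℕ → Type
  | var {Δ n} (x : Fin n) : Fm Δ n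
  | lam {Δ n} (M : Fm Δ (n + 1)) : Fm Δ n
  | klam {Δ n} (M : Fm (Δ + 1) n) : Fm Δ n
  | app {Δ n} (M N : Fm Δ n) : Fm Δ n
  | kapp {Δ n} (M : Fm Δ n) (k : Fin Δ) : Fm Δ n
  | pair {Δ n} (M N : Fm Δ n) : Fm Δ n
  | fst {Δ n} (M : Fm Δ n) : Fm Δ n
  | snd {Δ n} (M : Fm Δ n) : Fm Δ n
  | fix {Δ n} (M : Fm Δ (n + 1)) : Fm Δ n
  | star {Δ n} : Fm Δ n
  | tt {Δ n} : Fm Δ n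
  | ff {Δ n} : Fm Δ n
  | ite {Δ n} (M N O : Fm Δ n) : Fm Δ n
  | ze {Δ n} : Fm Δ n
  | su {Δ n} (M : Fm Δ n) : Fm Δ n
  | ifze {Δ n} (M N : Fm Δ n) (O : Fm Δ (n + 1)) : Fm Δ n
  | sup {Δ n} (M : Fm Δ n) (N : Fm Δ (n + 1)) : Fm Δ n
  | wrec {Δ n} (M : Fm Δ n) (N : Fm Δ (n + 3)) : Fm Δ n
  | pi {Δ n} (A : Fm Δ n) (B : Fm Δ (n + 1)) : Fm Δ n
  | sg {Δ n} (A : Fm Δ n) (B : Fm Δ (n + 1)) : Fm Δ n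
  | wty {Δ n} (A : Fm Δ n) (B : Fm Δ (n + 1)) : Fm Δ n
  | eqty {Δ n} (A M N : Fm Δ n) : Fm Δ n
  | kprod {Δ n} (A : Fm (Δ + 1) n) : Fm Δ n
  | kisect {Δ n} (A : Fm (Δ + 1) n) : Fm Δ n
  | later {Δ n} (k : Fin Δ) (A : Fm Δ n) : Fm Δ n
  | void {Δ n} : Fm Δ n
  | unit {Δ n} : Fm Δ n
  | bool {Δ n} : Fm Δ n
  | nat {Δ n} : Fm Δ n
  | univ {Δ n} (i : ℕ) : Fm Δ n

/-- Renaming of the free term variables. -/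
def Fm.rename : {Δ n m : ℕ} → (Fin n → Fin m) → Fm Δ n → Fm Δ m
  | _, _, _, r, var x => var (r x)
  | _, _, _, r, lam M => lam (M.rename (lift r))
  | _, _, _, r, klam M => klam (M.rename r)
  | _, _, _, r, app M N => app (M.rename r) (N.rename r)
  | _, _, _, r, kapp M k => kapp (M.rename r) k
  | _, _, _, r, pair M N => pair (M.rename r) (N.rename r)
  | _, _, _, r, fst M => fst (M.rename r)
  | _, _, _, r, snd M => snd (M.rename r)
  | _, _, _, r, fix M => fix (M.rename (lift r))
  | _, _, _, _, star => star
  | _, _, _, _, tt => tt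
  | _, _, _, _, ff => ff
  | _, _, _, r, ite M N O => ite (M.rename r) (N.rename r) (O.rename r)
  | _, _, _, _, ze => ze
  | _, _, _, r, su M => su (M.rename r)
  | _, _, _, r, ifze M N O => ifze (M.rename r) (N.rename r) (O.rename (lift r))
  | _, _, _, r, sup M N => sup (M.rename r) (N.rename (lift r))
  | _, _, _, r, wrec M N => wrec (M.rename r) (N.rename (lift (lift (lift r))))
  | _, _, _, r, pi A B => pi (A.rename r) (B.rename (lift r))
  | _, _, _, r, sg A B => sg (A.rename r) (B.rename (lift r))
  | _, _, _, r, wty A B => wty (A.rename r) (B.rename (lift r))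
  | _, _, _, r, eqty A M N => eqty (A.rename r) (M.rename r) (N.rename r)
  | _, _, _, r, kprod A => kprod (A.rename r)
  | _, _, _, r, kisect A => kisect (A.rename r)
  | _, _, _, r, later k A => later k (A.rename r)
  | _, _, _, _, void => void
  | _, _, _, _, unit => unit
  | _, _, _, _, bool => bool
  | _, _, _, _, nat => nat
  | _, _, _, _, univ i => univ i

/-- The term `M`, regarded as a term in a context with one more variable. -/
def Fm.weaken {Δ n : ℕ} (M : Fm Δ n) : Fm Δ (n + 1) := M.rename Fin.succ

/-- The type `A → B` of non-dependent functions. -/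
def Fm.arrow {Δ n : ℕ} (A B : Fm Δ n) : Fm Δ n := pi A B.weaken

/-- The fixed point combinator `λ f. fix x. f x`. -/
def Fm.fixComb {Δ n : ℕ} : Fm Δ n := lam (fix (app (var 1) (var 0)))

/-- Typing contexts `x₁ : A₁, …, xₙ : Aₙ` over `Δ` clock variables. -/
inductive Ctx (Δ : ℕ) : ℕ → Type
  | nil : Ctx Δ 0
  | snoc {n : ℕ} (Γ : Ctx Δ n) (A : Fm Δ n) : Ctx Δ (n + 1)

/-! ## Programs -/

/-- Programs with `n` free variables at a world with `c` clocks. As a presheaf on worlds this is the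
object of programs; it does not depend on the time assignment. The body of a clock binder is an
element of the exponential of this presheaf by the presheaf of clock names, and since the latter is
representable on the category of non-empty clock contexts, that exponential is the shift
`Pg (c + 1) n` (see `Pg.clockExp`). -/
inductive Pg : ℕ → ℕ → Type
  | var {c n} (x : Fin n) : Pg c n
  | lam {c n} (M : Pg c (n + 1)) : Pg c n
  | klam {c n} (M : Pg (c + 1) n) : Pg c n
  | app {c n} (M N : Pg c n) : Pg c n
  | kapp {c n} (M : Pg c n) (κ : Fin c) : Pg c n
  | pair {c n} (M N : Pg c n) : Pg c n
  | fst {c n} (M : Pg c n) : Pg c n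
  | snd {c n} (M : Pg c n) : Pg c n
  | fix {c n} (M : Pg c (n + 1)) : Pg c n
  | star {c n} : Pg c n
  | tt {c n} : Pg c n
  | ff {c n} : Pg c n
  | ite {c n} (M N O : Pg c n) : Pg c n
  | ze {c n} : Pg c n
  | su {c n} (M : Pg c n) : Pg c n
  | ifze {c n} (M N : Pg c n) (O : Pg c (n + 1)) : Pg c n
  | sup {c n} (M : Pg c n) (N : Pg c (n + 1)) : Pg c n
  | wrec {c n} (M : Pg c n) (N : Pg c (n + 3)) : Pg c n
  | pi {c n} (A : Pg c n) (B : Pg c (n + 1)) : Pg c n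
  | sg {c n} (A : Pg c n) (B : Pg c (n + 1)) : Pg c n
  | wty {c n} (A : Pg c n) (B : Pg c (n + 1)) : Pg c n
  | eqty {c n} (A M N : Pg c n) : Pg c n
  | kprod {c n} (A : Pg (c + 1) n) : Pg c n
  | kisect {c n} (A : Pg (c + 1) n) : Pg c n
  | later {c n} (κ : Fin c) (A : Pg c n) : Pg c n
  | void {c n} : Pg c n
  | unit {c n} : Pg c n
  | bool {c n} : Pg c n
  | nat {c n} : Pg c n
  | univ {c n} (i : ℕ) : Pg c n

namespace Pg

/-- The action of maps of clock names on programs. -/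
def mapClk : {c d n : ℕ} → (Fin c → Fin d) → Pg c n → Pg d n
  | _, _, _, _, var x => var x
  | _, _, _, f, lam M => lam (M.mapClk f)
  | _, _, _, f, klam M => klam (M.mapClk (lift f))
  | _, _, _, f, app M N => app (M.mapClk f) (N.mapClk f)
  | _, _, _, f, kapp M κ => kapp (M.mapClk f) (f κ)
  | _, _, _, f, pair M N => pair (M.mapClk f) (N.mapClk f)
  | _, _, _, f, fst M => fst (M.mapClk f)
  | _, _, _, f, snd M => snd (M.mapClk f)
  | _, _, _, f, fix M => fix (M.mapClk f)
  | _, _, _, _, star => star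
  | _, _, _, _, tt => tt
  | _, _, _, _, ff => ff
  | _, _, _, f, ite M N O => ite (M.mapClk f) (N.mapClk f) (O.mapClk f)
  | _, _, _, _, ze => ze
  | _, _, _, f, su M => su (M.mapClk f)
  | _, _, _, f, ifze M N O => ifze (M.mapClk f) (N.mapClk f) (O.mapClk f)
  | _, _, _, f, sup M N => sup (M.mapClk f) (N.mapClk f)
  | _, _, _, f, wrec M N => wrec (M.mapClk f) (N.mapClk f)
  | _, _, _, f, pi A B => pi (A.mapClk f) (B.mapClk f)
  | _, _, _, f, sg A B => sg (A.mapClk f) (B.mapClk f)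
  | _, _, _, f, wty A B => wty (A.mapClk f) (B.mapClk f)
  | _, _, _, f, eqty A M N => eqty (A.mapClk f) (M.mapClk f) (N.mapClk f)
  | _, _, _, f, kprod A => kprod (A.mapClk (lift f))
  | _, _, _, f, kisect A => kisect (A.mapClk (lift f))
  | _, _, _, f, later κ A => later (f κ) (A.mapClk f)
  | _, _, _, _, void => void
  | _, _, _, _, unit => unit
  | _, _, _, _, bool => bool
  | _, _, _, _, nat => nat
  | _, _, _, _, univ i => univ i

/-- Renaming of the free term variables. -/
def rename : {c n m : ℕ} → (Fin n → Fin m) → Pg c n → Pg c m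
  | _, _, _, r, var x => var (r x)
  | _, _, _, r, lam M => lam (M.rename (lift r))
  | _, _, _, r, klam M => klam (M.rename r)
  | _, _, _, r, app M N => app (M.rename r) (N.rename r)
  | _, _, _, r, kapp M κ => kapp (M.rename r) κ
  | _, _, _, r, pair M N => pair (M.rename r) (N.rename r)
  | _, _, _, r, fst M => fst (M.rename r)
  | _, _, _, r, snd M => snd (M.rename r)
  | _, _, _, r, fix M => fix (M.rename (lift r))
  | _, _, _, _, star => star
  | _, _, _, _, tt => tt
  | _, _, _, _, ff => ff
  | _, _, _, r, ite M N O => ite (M.rename r) (N.rename r) (O.rename r)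
  | _, _, _, _, ze => ze
  | _, _, _, r, su M => su (M.rename r)
  | _, _, _, r, ifze M N O => ifze (M.rename r) (N.rename r) (O.rename (lift r))
  | _, _, _, r, sup M N => sup (M.rename r) (N.rename (lift r))
  | _, _, _, r, wrec M N => wrec (M.rename r) (N.rename (lift (lift (lift r))))
  | _, _, _, r, pi A B => pi (A.rename r) (B.rename (lift r))
  | _, _, _, r, sg A B => sg (A.rename r) (B.rename (lift r))
  | _, _, _, r, wty A B => wty (A.rename r) (B.rename (lift r))
  | _, _, _, r, eqty A M N => eqty (A.rename r) (M.rename r) (N.rename r)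
  | _, _, _, r, kprod A => kprod (A.rename r)
  | _, _, _, r, kisect A => kisect (A.rename r)
  | _, _, _, r, later κ A => later κ (A.rename r)
  | _, _, _, _, void => void
  | _, _, _, _, unit => unit
  | _, _, _, _, bool => bool
  | _, _, _, _, nat => nat
  | _, _, _, _, univ i => univ i

/-- A substitution, extended to a newly bound term variable. -/
def up {c n m : ℕ} (γ : Fin n → Pg c m) : Fin (n + 1) → Pg c (m + 1) :=
  ext (rename Fin.succ ∘ γ) (var 0)

/-- Simultaneous capture-avoiding substitution. -/
def subst : {c n m : ℕ} → (Fin n → Pg c m) → Pg c n → Pg c m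
  | _, _, _, γ, var x => γ x
  | _, _, _, γ, lam M => lam (M.subst (up γ))
  | _, _, _, γ, klam M => klam (M.subst (mapClk Fin.succ ∘ γ))
  | _, _, _, γ, app M N => app (M.subst γ) (N.subst γ)
  | _, _, _, γ, kapp M κ => kapp (M.subst γ) κ
  | _, _, _, γ, pair M N => pair (M.subst γ) (N.subst γ)
  | _, _, _, γ, fst M => fst (M.subst γ)
  | _, _, _, γ, snd M => snd (M.subst γ)
  | _, _, _, γ, fix M => fix (M.subst (up γ))
  | _, _, _, _, star => star
  | _, _, _, _, tt => tt
  | _, _, _, _, ff => ff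
  | _, _, _, γ, ite M N O => ite (M.subst γ) (N.subst γ) (O.subst γ)
  | _, _, _, _, ze => ze
  | _, _, _, γ, su M => su (M.subst γ)
  | _, _, _, γ, ifze M N O => ifze (M.subst γ) (N.subst γ) (O.subst (up γ))
  | _, _, _, γ, sup M N => sup (M.subst γ) (N.subst (up γ))
  | _, _, _, γ, wrec M N => wrec (M.subst γ) (N.subst (up (up (up γ))))
  | _, _, _, γ, pi A B => pi (A.subst γ) (B.subst (up γ))
  | _, _, _, γ, sg A B => sg (A.subst γ) (B.subst (up γ))
  | _, _, _, γ, wty A B => wty (A.subst γ) (B.subst (up γ))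
  | _, _, _, γ, eqty A M N => eqty (A.subst γ) (M.subst γ) (N.subst γ)
  | _, _, _, γ, kprod A => kprod (A.subst (mapClk Fin.succ ∘ γ))
  | _, _, _, γ, kisect A => kisect (A.subst (mapClk Fin.succ ∘ γ))
  | _, _, _, γ, later κ A => later κ (A.subst γ)
  | _, _, _, _, void => void
  | _, _, _, _, unit => unit
  | _, _, _, _, bool => bool
  | _, _, _, _, nat => nat
  | _, _, _, _, univ i => univ i

/-- The program `[N / x] M`, where `x` is the newest variable of `M`. -/
def inst {c n : ℕ} (M : Pg c (n + 1)) (N : Pg c n) : Pg c n := M.subst (ext var N)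

/-- The value at the clock `κ` of a clock-indexed family of programs. -/
def instClk {c n : ℕ} (M : Pg (c + 1) n) (κ : Fin c) : Pg c n := M.mapClk (ext id κ)

theorem mapClk_id {c n : ℕ} (M : Pg c n) : M.mapClk id = M := by
  induction M <;> simp_all [mapClk]

theorem mapClk_mapClk {c n : ℕ} (M : Pg c n) : ∀ {d e : ℕ} (f : Fin d → Fin e) (g : Fin c → Fin d),
    (M.mapClk g).mapClk f = M.mapClk (f ∘ g) := by
  induction M <;> intros <;> simp_all [mapClk, lift_comp]

theorem rename_mapClk {c n : ℕ} (M : Pg c n) : ∀ {d m : ℕ} (f : Fin c → Fin d) (r : Fin n → Fin m),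
    (M.rename r).mapClk f = (M.mapClk f).rename r := by
  induction M <;> intros <;> simp_all [mapClk, rename]

theorem up_mapClk {c d n m : ℕ} (f : Fin c → Fin d) (γ : Fin n → Pg c m) :
    mapClk f ∘ up γ = up (mapClk f ∘ γ) := by
  funext i; induction i using Fin.cases <;> simp [up, mapClk, rename_mapClk]

theorem subst_mapClk {c n : ℕ} (M : Pg c n) : ∀ {d m : ℕ} (f : Fin c → Fin d) (γ : Fin n → Pg c m),
    (M.subst γ).mapClk f = (M.mapClk f).subst (mapClk f ∘ γ) := by
  have key : ∀ {c d n m : ℕ} (f : Fin c → Fin d) (γ : Fin n → Pg c m),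
      mapClk (lift f) ∘ mapClk Fin.succ ∘ γ = mapClk Fin.succ ∘ mapClk f ∘ γ := by
    intros; funext i; simp only [Function.comp, mapClk_mapClk]; rfl
  induction M <;> intros <;> simp only [mapClk, subst, up_mapClk, Function.comp_apply, *]

theorem inst_mapClk {c d n : ℕ} (f : Fin c → Fin d) (M : Pg c (n + 1)) (N : Pg c n) :
    (M.inst N).mapClk f = (M.mapClk f).inst (N.mapClk f) := by
  rw [inst, subst_mapClk, comp_ext]; rfl

theorem instClk_mapClk {c d n : ℕ} (f : Fin c → Fin d) (M : Pg (c + 1) n) (κ : Fin c) :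
    (M.instClk κ).mapClk f = (M.mapClk (lift f)).instClk (f κ) := by
  rw [instClk, instClk, mapClk_mapClk, mapClk_mapClk]
  congr 1
  funext i; induction i using Fin.cases <;> rfl

/-- The canonical forms. -/
inductive Val : {c : ℕ} → Pg c 0 → Prop
  | lam {c} (M : Pg c 1) : Val (lam M)
  | klam {c} (M : Pg (c + 1) 0) : Val (klam M)
  | pair {c} (M N : Pg c 0) : Val (pair M N)
  | star {c} : Val (star : Pg c 0)
  | tt {c} : Val (tt : Pg c 0)
  | ff {c} : Val (ff : Pg c 0)
  | ze {c} : Val (ze : Pg c 0)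
  | su {c} (M : Pg c 0) : Val (su M)
  | sup {c} (M : Pg c 0) (N : Pg c 1) : Val (sup M N)
  | pi {c} (A : Pg c 0) (B : Pg c 1) : Val (pi A B)
  | sg {c} (A : Pg c 0) (B : Pg c 1) : Val (sg A B)
  | wty {c} (A : Pg c 0) (B : Pg c 1) : Val (wty A B)
  | eqty {c} (A M N : Pg c 0) : Val (eqty A M N)
  | kprod {c} (A : Pg (c + 1) 0) : Val (kprod A)
  | kisect {c} (A : Pg (c + 1) 0) : Val (kisect A)
  | later {c} (κ : Fin c) (A : Pg c 0) : Val (later κ A)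
  | void {c} : Val (void : Pg c 0)
  | unit {c} : Val (unit : Pg c 0)
  | bool {c} : Val (bool : Pg c 0)
  | nat {c} : Val (nat : Pg c 0)
  | univ {c} (i : ℕ) : Val (univ i : Pg c 0)

/-- The function that calls the recursor `wrec - O` on the immediate subtrees `N`. -/
def wcall {c : ℕ} (N : Pg c 1) (O : Pg c 3) : Pg c 0 :=
  lam (wrec N (O.rename (lift (lift (lift Fin.succ)))))

/-- Structural operational semantics of closed programs. -/
inductive Step : {c : ℕ} → Pg c 0 → Pg c 0 → Prop
  | app {c} {M M' : Pg c 0} (N : Pg c 0) : Step M M' → Step (app M N) (app M' N)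
  | kapp {c} {M M' : Pg c 0} (κ : Fin c) : Step M M' → Step (kapp M κ) (kapp M' κ)
  | fst {c} {M M' : Pg c 0} : Step M M' → Step (fst M) (fst M')
  | snd {c} {M M' : Pg c 0} : Step M M' → Step (snd M) (snd M')
  | ite {c} {M M' : Pg c 0} (N O : Pg c 0) : Step M M' → Step (ite M N O) (ite M' N O)
  | ifze {c} {M M' : Pg c 0} (N : Pg c 0) (O : Pg c 1) :
      Step M M' → Step (ifze M N O) (ifze M' N O)
  | wrec {c} {M M' : Pg c 0} (O : Pg c 3) : Step M M' → Step (wrec M O) (wrec M' O)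
  | app_lam {c} (M : Pg c 1) (N : Pg c 0) : Step (app (lam M) N) (M.inst N)
  | kapp_klam {c} (M : Pg (c + 1) 0) (κ : Fin c) : Step (kapp (klam M) κ) (M.instClk κ)
  | fst_pair {c} (M N : Pg c 0) : Step (fst (pair M N)) M
  | snd_pair {c} (M N : Pg c 0) : Step (snd (pair M N)) N
  | ite_tt {c} (N O : Pg c 0) : Step (ite tt N O) N
  | ite_ff {c} (N O : Pg c 0) : Step (ite ff N O) O
  | ifze_ze {c} (N : Pg c 0) (O : Pg c 1) : Step (ifze ze N O) N
  | ifze_su {c} (M N : Pg c 0) (O : Pg c 1) : Step (ifze (su M) N O) (O.inst M)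
  | wrec_sup {c} (M : Pg c 0) (N : Pg c 1) (O : Pg c 3) :
      Step (wrec (sup M N) O) (O.subst (ext (ext (ext var M) (lam N)) (wcall N O)))
  | fix {c} (M : Pg c 1) : Step (fix M) (M.inst (fix M))

/-- `Eval M N`: the program `M` evaluates, in finitely many steps, to the value `N`. -/
def Eval {c : ℕ} (M N : Pg c 0) : Prop := Relation.ReflTransGen Step M N ∧ Val N

theorem Val.map {c d : ℕ} (f : Fin c → Fin d) {M : Pg c 0} (h : Val M) : Val (M.mapClk f) := by
  cases h <;> constructor

theorem Step.map {c : ℕ} {M N : Pg c 0} (h : Step M N) :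
    ∀ {d : ℕ} (f : Fin c → Fin d), Step (M.mapClk f) (N.mapClk f) := by
  induction h with
  | app_lam M N => intro d f; rw [inst_mapClk]; exact .app_lam _ _
  | kapp_klam M κ => intro d f; rw [instClk_mapClk]; exact .kapp_klam _ _
  | ifze_su M N O => intro d f; rw [inst_mapClk]; exact .ifze_su _ _ _
  | fix M => intro d f; rw [inst_mapClk]; exact .fix _
  | wrec_sup M N O =>
    intro d f
    rw [subst_mapClk, comp_ext, comp_ext, comp_ext]
    simp only [wcall, mapClk, rename_mapClk]
    exact .wrec_sup _ _ _
  | _ => intros; simp only [mapClk]; constructor <;> solve_by_elim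

theorem Eval.map {c d : ℕ} (f : Fin c → Fin d) {M N : Pg c 0} (h : Eval M N) :
    Eval (M.mapClk f) (N.mapClk f) :=
  ⟨h.1.lift _ fun _ _ hs => hs.map f, h.2.map f⟩

/-- The restriction of programs along a morphism of worlds. -/
def res {V W : World} (f : V ⟶ W) {n : ℕ} (M : Pg W.card n) : Pg V.card n := M.mapClk f.fn

theorem res_id {W : World} {n : ℕ} (M : Pg W.card n) : res (𝟙 W) M = M := mapClk_id M

theorem res_comp {U V W : World} (g : U ⟶ V) (f : V ⟶ W) {n : ℕ} (M : Pg W.card n) :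
    res (g ≫ f) M = res g (res f M) := by
  rw [res, res, res, mapClk_mapClk]; rfl

/-- The value at `f` and `κ` of a clock-indexed family of programs over `W`. -/
def at_ {V W : World} (f : V ⟶ W) (κ : Clk V) {n : ℕ} (M : Pg (W.card + 1) n) : Pg V.card n :=
  M.mapClk (ext f.fn κ)

theorem at_comp {U V W : World} (g : U ⟶ V) (f : V ⟶ W) (κ : Clk V) {n : ℕ}
    (M : Pg (W.card + 1) n) : at_ (g ≫ f) (g.fn κ) M = res g (at_ f κ M) := by
  rw [at_, at_, res, mapClk_mapClk, comp_ext]; rfl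

theorem at_res {U V W : World} (g : U ⟶ V) (f : V ⟶ W) (κ : Clk U) {n : ℕ}
    (M : Pg (W.card + 1) n) : at_ (g ≫ f) κ M = at_ g κ (M.mapClk (lift f.fn)) := by
  rw [at_, at_, mapClk_mapClk]; congr 1
  funext i; induction i using Fin.cases <;> rfl

end Pg

/-- The world `W`, extended by a new clock `0` on which time `t` is left. -/
def World.snoc (W : World) (t : ℕ) : World := ⟨W.card + 1, Nat.succ_pos _, ext W.time t⟩

/-- The values at `W` of the exponential of the presheaf of programs by the presheaf of clocks, i.e.
the natural families of programs indexed by the clocks of all worlds over `W`, are exactly the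
programs with one more clock. -/
def Pg.clockExp (W : World) (n : ℕ) : Pg (W.card + 1) n ≃
    { F : ∀ V : World, (V ⟶ W) → Clk V → Pg V.card n //
      ∀ (U V : World) (g : U ⟶ V) (f : V ⟶ W) (κ : Clk V),
        F U (g ≫ f) (g.fn κ) = Pg.res g (F V f κ) } where
  toFun M := ⟨fun _ f κ => Pg.at_ f κ M, fun _ _ g f κ => Pg.at_comp g f κ M⟩
  invFun F := F.1 (W.snoc 0) ⟨Fin.succ, fun _ => le_rfl⟩ (0 : Fin (W.card + 1))
  left_inv M := by
    have : ext Fin.succ (0 : Fin (W.card + 1)) = id := by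
      funext i; induction i using Fin.cases <;> rfl
    change M.mapClk (ext Fin.succ (0 : Fin (W.card + 1))) = M
    rw [this, Pg.mapClk_id]
  right_inv F := by
    apply Subtype.ext
    funext V f κ
    let p (t : ℕ) : W.snoc t ⟶ W := ⟨Fin.succ, fun _ => le_rfl⟩
    let q (t : ℕ) (h : V.time κ ≤ t) : V ⟶ W.snoc t :=
      ⟨ext f.fn κ, fun i => by induction i using Fin.cases; exacts [h, f.le_time _]⟩
    let s : W.snoc 0 ⟶ W.snoc (V.time κ) :=
      ⟨id, fun i => by induction i using Fin.cases; exacts [Nat.zero_le _, le_rfl]⟩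
    have h1 := F.2 _ _ s (p (V.time κ)) (0 : Fin (W.card + 1))
    have h2 := F.2 _ _ (q _ le_rfl) (p (V.time κ)) (0 : Fin (W.card + 1))
    have h3 : Pg.res s (F.1 _ (p (V.time κ)) (0 : Fin (W.card + 1))) =
        F.1 _ (p (V.time κ)) (0 : Fin (W.card + 1)) := Pg.mapClk_id _
    rw [h3] at h1
    rw [← h1] at h2
    exact h2.symm

/-! ## Elaboration of formal terms to programs -/

/-- The program `⟦M⟧ϱ`, for an environment `ϱ` of clocks. -/
def Fm.interp : {Δ n c : ℕ} → Fm Δ n → (Fin Δ → Fin c) → Pg c n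
  | _, _, _, var x, _ => .var x
  | _, _, _, lam M, ϱ => .lam (M.interp ϱ)
  | _, _, _, klam M, ϱ => .klam (M.interp (ext (Fin.succ ∘ ϱ) 0))
  | _, _, _, app M N, ϱ => .app (M.interp ϱ) (N.interp ϱ)
  | _, _, _, kapp M k, ϱ => .kapp (M.interp ϱ) (ϱ k)
  | _, _, _, pair M N, ϱ => .pair (M.interp ϱ) (N.interp ϱ)
  | _, _, _, fst M, ϱ => .fst (M.interp ϱ)
  | _, _, _, snd M, ϱ => .snd (M.interp ϱ)
  | _, _, _, fix M, ϱ => .fix (M.interp ϱ)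
  | _, _, _, star, _ => .star
  | _, _, _, tt, _ => .tt
  | _, _, _, ff, _ => .ff
  | _, _, _, ite M N O, ϱ => .ite (M.interp ϱ) (N.interp ϱ) (O.interp ϱ)
  | _, _, _, ze, _ => .ze
  | _, _, _, su M, ϱ => .su (M.interp ϱ)
  | _, _, _, ifze M N O, ϱ => .ifze (M.interp ϱ) (N.interp ϱ) (O.interp ϱ)
  | _, _, _, sup M N, ϱ => .sup (M.interp ϱ) (N.interp ϱ)
  | _, _, _, wrec M N, ϱ => .wrec (M.interp ϱ) (N.interp ϱ)
  | _, _, _, pi A B, ϱ => .pi (A.interp ϱ) (B.interp ϱ)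
  | _, _, _, sg A B, ϱ => .sg (A.interp ϱ) (B.interp ϱ)
  | _, _, _, wty A B, ϱ => .wty (A.interp ϱ) (B.interp ϱ)
  | _, _, _, eqty A M N, ϱ => .eqty (A.interp ϱ) (M.interp ϱ) (N.interp ϱ)
  | _, _, _, kprod A, ϱ => .kprod (A.interp (ext (Fin.succ ∘ ϱ) 0))
  | _, _, _, kisect A, ϱ => .kisect (A.interp (ext (Fin.succ ∘ ϱ) 0))
  | _, _, _, later k A, ϱ => .later (ϱ k) (A.interp ϱ)
  | _, _, _, void, _ => .void
  | _, _, _, unit, _ => .unit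
  | _, _, _, bool, _ => .bool
  | _, _, _, nat, _ => .nat
  | _, _, _, univ i, _ => .univ i

/-- Telescopes of programs. -/
inductive Tl (c : ℕ) : ℕ → Type
  | nil : Tl c 0
  | snoc {n : ℕ} (Γ : Tl c n) (A : Pg c n) : Tl c (n + 1)

/-- The restriction of telescopes along a morphism of worlds. -/
def Tl.res {V W : World} (f : V ⟶ W) : {n : ℕ} → Tl W.card n → Tl V.card n
  | _, .nil => .nil
  | _, .snoc Γ A => .snoc (Tl.res f Γ) (Pg.res f A)

/-- The telescope `⟦Γ⟧ϱ`. -/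
def Ctx.interp {Δ c : ℕ} (ϱ : Fin Δ → Fin c) : {n : ℕ} → Ctx Δ n → Tl c n
  | _, .nil => .nil
  | _, .snoc Γ A => .snoc (Ctx.interp ϱ Γ) (A.interp ϱ)

/-! ## Relations on closed programs -/

/-- The binary relations on closed programs at the world `W`, i.e. the value at `W` of the power
object of the square of the presheaf of closed programs. -/
@[ext]
structure Rel (W : World) where
  mem : ∀ {V : World}, (V ⟶ W) → Pg V.card 0 → Pg V.card 0 → Prop
  stable : ∀ {U V : World} (g : U ⟶ V) (f : V ⟶ W) (M N : Pg V.card 0),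
    mem f M N → mem (g ≫ f) (Pg.res g M) (Pg.res g N)

namespace Rel

/-- `R.holds M N`: the pair `(M, N)` belongs to `R` at the present world. -/
def holds {W : World} (R : Rel W) (M N : Pg W.card 0) : Prop := R.mem (𝟙 W) M N

/-- Restriction of relations along a morphism of worlds. -/
def res {V W : World} (f : V ⟶ W) (R : Rel W) : Rel V where
  mem g M N := R.mem (g ≫ f) M N
  stable h g M N hR := by
    have := R.stable h (g ≫ f) M N hR
    rwa [← Category.assoc] at this

theorem res_comp {U V W : World} (g : U ⟶ V) (f : V ⟶ W) (R : Rel W) :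
    res (g ≫ f) R = res g (res f R) := by
  ext; simp [res]

@[simp] theorem holds_res {V W : World} (f : V ⟶ W) (R : Rel W) (M N : Pg V.card 0) :
    (res f R).holds M N ↔ R.mem f M N := by
  simp [holds, res]

theorem holds_stable {V W : World} (f : V ⟶ W) (R : Rel W) {M N : Pg W.card 0}
    (h : R.holds M N) : R.mem f (Pg.res f M) (Pg.res f N) := by
  simpa using R.stable f (𝟙 W) M N h

instance (W : World) : PartialOrder (Rel W) where
  le R S := ∀ (V : World) (f : V ⟶ W) (M N : Pg V.card 0), R.mem f M N → S.mem f M N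
  le_refl _ _ _ _ _ h := h
  le_trans _ _ _ h k V f M N hR := k V f M N (h V f M N hR)
  le_antisymm R S h k := by
    ext V f M N; exact ⟨h V f M N, k V f M N⟩

instance (W : World) : InfSet (Rel W) where
  sInf 𝒮 :=
    { mem := fun f M N => ∀ R ∈ 𝒮, Rel.mem R f M N
      stable := fun g f M N h R hR => R.stable g f M N (h R hR) }

instance (W : World) : CompleteLattice (Rel W) :=
  completeLatticeOfInf (Rel W) fun _ =>
    ⟨fun _ hR _ _ _ _ h => h _ hR, fun _ hR V f M N h _ hS' => hR hS' V f M N h⟩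

/-- Least fixed points of operators on relations that commute with restriction do so, too. -/
theorem lfp_res {V W : World} (f : V ⟶ W) (F : Rel W →o Rel W) (G : Rel V →o Rel V)
    (h : ∀ R, res f (F R) = G (res f R)) : res f F.lfp = G.lfp := by
  apply le_antisymm
  · let S : Rel W :=
      { mem := fun {V'} g M N => ∀ (U : World) (p : U ⟶ V') (q : U ⟶ V), p ≫ g = q ≫ f →
          G.lfp.mem q (Pg.res p M) (Pg.res p N)
        stable := by
          intro U V' p g M N hS U' p' q e
          rw [← Pg.res_comp, ← Pg.res_comp]
          exact hS U' (p' ≫ p) q (by rw [Category.assoc, e]) }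
    have hSV : res f S ≤ G.lfp := by
      intro U g M N hM
      have := hM U (𝟙 U) g (by simp)
      rwa [Pg.res_id, Pg.res_id] at this
    have hS : F S ≤ S := by
      intro V' g M N hM U p q e
      have h1 := (F S).stable p g M N hM
      rw [e] at h1
      have h2 : (res f (F S)).mem q (Pg.res p M) (Pg.res p N) := h1
      rw [h] at h2
      have h3 := G.monotone hSV
      rw [G.map_lfp] at h3
      exact h3 _ _ _ _ h2
    intro U g M N hM
    exact hSV U g M N (F.lfp_le hS _ _ _ _ hM)
  · apply G.lfp_le
    rw [← h, F.map_lfp]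

/-- The closure of a relation under evaluation to canonical form. -/
def valClo {W : World} (R : Rel W) : Rel W where
  mem f M N := ∃ M' N', Pg.Eval M M' ∧ Pg.Eval N N' ∧ R.mem f M' N'
  stable g f M N := by
    rintro ⟨M', N', hM, hN, h⟩
    exact ⟨_, _, hM.map g.fn, hN.map g.fn, R.stable g f _ _ h⟩

theorem valClo_mono {W : World} {R S : Rel W} (h : R ≤ S) : R.valClo ≤ S.valClo := by
  rintro V f M N ⟨M', N', hM, hN, hR⟩
  exact ⟨M', N', hM, hN, h _ _ _ _ hR⟩

theorem valClo_res {V W : World} (f : V ⟶ W) (R : Rel W) : res f R.valClo = (res f R).valClo := rfl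

end Rel

/-- Families of relations indexed by closed programs: the value at `W` of the exponential. -/
@[ext]
structure Fam (W : World) where
  app : ∀ {V : World}, (V ⟶ W) → Pg V.card 0 → Rel V
  natural : ∀ {U V : World} (g : U ⟶ V) (f : V ⟶ W) (M : Pg V.card 0),
    app (g ≫ f) (Pg.res g M) = (app f M).res g

/-- Restriction along a morphism of worlds. -/
def Fam.res {V W : World} (f : V ⟶ W) (B : Fam W) : Fam V where
  app g M := B.app (g ≫ f) M
  natural h g M := by rw [Category.assoc, B.natural]

/-- Families of relations indexed by clocks: the value at `W` of the exponential. -/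
@[ext]
structure KFam (W : World) where
  app : ∀ {V : World}, (V ⟶ W) → Clk V → Rel V
  natural : ∀ {U V : World} (g : U ⟶ V) (f : V ⟶ W) (κ : Clk V),
    app (g ≫ f) (g.fn κ) = (app f κ).res g

/-- Restriction along a morphism of worlds. -/
def KFam.res {V W : World} (f : V ⟶ W) (A : KFam W) : KFam V where
  app g κ := A.app (g ≫ f) κ
  natural h g κ := by rw [Category.assoc, A.natural]

/-! ## The meanings of the connectives -/

namespace Rel

/-- The empty relation. -/
def emptyRel (W : World) : Rel W := ⟨fun _ _ _ => False, fun _ _ _ _ h => h⟩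

/-- The relation that consists of `(⋆, ⋆)`. -/
def unitRel (W : World) : Rel W where
  mem _ M N := M = .star ∧ N = .star
  stable g f M N := by rintro ⟨rfl, rfl⟩; exact ⟨rfl, rfl⟩

/-- The relation that consists of `(tt, tt)` and `(ff, ff)`. -/
def boolRel (W : World) : Rel W where
  mem _ M N := (M = .tt ∧ N = .tt) ∨ (M = .ff ∧ N = .ff)
  stable g f M N := by
    rintro (⟨rfl, rfl⟩ | ⟨rfl, rfl⟩)
    exacts [.inl ⟨rfl, rfl⟩, .inr ⟨rfl, rfl⟩]

/-- The operator `Y ↦ {(ze, ze)} ∪ {(su M₀, su M₁) | (M₀, M₁) ∈ valClo Y}`. -/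
def natOp (W : World) : Rel W →o Rel W where
  toFun Y :=
    { mem := fun f M N => (M = .ze ∧ N = .ze) ∨
        ∃ M' N', M = .su M' ∧ N = .su N' ∧ Y.valClo.mem f M' N'
      stable := by
        rintro U V g f M N (⟨rfl, rfl⟩ | ⟨M', N', rfl, rfl, h⟩)
        · exact .inl ⟨rfl, rfl⟩
        · exact .inr ⟨_, _, rfl, rfl, Y.valClo.stable g f _ _ h⟩ }
  monotone' := by
    rintro Y Z hYZ V f M N (h | ⟨M', N', hM, hN, h⟩)
    · exact .inl h
    · exact .inr ⟨M', N', hM, hN, valClo_mono hYZ _ _ _ _ h⟩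

/-- The relation of dependent pairs. -/
def sgRel {W : World} (A : Rel W) (B : Fam W) : Rel W where
  mem f M N := A.mem f (.fst M) (.fst N) ∧ (B.app f (.fst M)).holds (.snd M) (.snd N)
  stable g f M N := by
    rintro ⟨hA, hB⟩
    refine ⟨A.stable g f _ _ hA, ?_⟩
    have := holds_stable g _ hB
    rw [← holds_res, ← B.natural] at this
    exact this

/-- The relation of dependent functions. -/
def piRel {W : World} (A : Rel W) (B : Fam W) : Rel W where
  mem {V} f M N := ∀ (U : World) (g : U ⟶ V) (O P : Pg U.card 0), A.mem (g ≫ f) O P →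
    (B.app (g ≫ f) O).holds (.app (Pg.res g M) O) (.app (Pg.res g N) P)
  stable g f M N h U k O P hA := by
    rw [← Category.assoc] at hA ⊢
    rw [← Pg.res_comp, ← Pg.res_comp]
    exact h U (k ≫ g) O P hA

/-- The operator whose least fixed point consists of the pairs of equal well-founded trees. -/
def wOp {W : World} (A : Rel W) (B : Fam W) : Rel W →o Rel W where
  toFun Y :=
    { mem := fun {V} f M N => ∃ M₀ N₀ M₁ N₁, M = .sup M₀ N₀ ∧ N = .sup M₁ N₁ ∧ A.mem f M₀ M₁ ∧
        ∀ (U : World) (g : U ⟶ V) (O P : Pg U.card 0),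
          (B.app (g ≫ f) (Pg.res g M₀)).holds O P →
          Y.valClo.mem (g ≫ f) ((Pg.res g N₀).inst O) ((Pg.res g N₁).inst P)
      stable := by
        rintro U V g f M N ⟨M₀, N₀, M₁, N₁, rfl, rfl, hA, h⟩
        refine ⟨_, _, _, _, rfl, rfl, A.stable g f _ _ hA, fun U' k O P hB => ?_⟩
        change (B.app (k ≫ g ≫ f) (Pg.res k (Pg.res g M₀))).holds O P at hB
        change Y.valClo.mem (k ≫ g ≫ f) ((Pg.res k (Pg.res g N₀)).inst O)
          ((Pg.res k (Pg.res g N₁)).inst P)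
        rw [← Pg.res_comp] at hB ⊢
        rw [← Pg.res_comp]
        rw [← Category.assoc] at hB ⊢
        exact h U' (k ≫ g) O P hB }
  monotone' := by
    rintro Y Z hYZ V f M N ⟨M₀, N₀, M₁, N₁, hM, hN, hA, h⟩
    exact ⟨M₀, N₀, M₁, N₁, hM, hN, hA, fun U g O P hB =>
      valClo_mono hYZ _ _ _ _ (h U g O P hB)⟩

/-- The relation `{(⋆, ⋆) | (M₀, M₁) ∈ A}`. -/
def eqRel {W : World} (A : Rel W) (M₀ M₁ : Pg W.card 0) : Rel W where
  mem f M N := M = .star ∧ N = .star ∧ A.mem f (Pg.res f M₀) (Pg.res f M₁)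
  stable g f M N := by
    rintro ⟨rfl, rfl, h⟩
    refine ⟨rfl, rfl, ?_⟩
    rw [Pg.res_comp, Pg.res_comp]
    exact A.stable g f _ _ h

end Rel

/-- Later modalities are stable under restriction. -/
theorem Later.stable {V W : World} (f : V ⟶ W) (κ : Clk W)
    (φ : ∀ {U : World}, (U ⟶ W) → Prop)
    (hφ : ∀ {U U' : World} (g : U' ⟶ U) (k : U ⟶ W), φ k → φ (g ≫ k)) (h : Later κ φ) :
    Later (f.fn κ) (fun {_} g => φ (g ≫ f)) := by
  intro m hm
  obtain ⟨m', hm'⟩ : ∃ m', W.time κ = m' + 1 :=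
    Nat.exists_eq_succ_of_ne_zero (by have := f.le_time κ; omega)
  have hle := f.le_time κ
  have key : ∀ j : Clk W, (V.set (f.fn κ) m).time (f.fn j) ≤ (W.set κ m').time j := by
    intro j
    have hj := f.le_time j
    by_cases h1 : j = κ
    · subst h1; simp only [World.set, Function.update_self]; omega
    · by_cases h2 : f.fn j = f.fn κ
      · simp only [World.set, h2, Function.update_self, Function.update_of_ne h1]
        rw [h2] at hj; omega
      · simpa only [World.set, Function.update_of_ne h2, Function.update_of_ne h1] using hj
  let f' : V.set (f.fn κ) m ⟶ W.set κ m' := ⟨f.fn, key⟩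
  have e : tick (f.fn κ) m hm ≫ f = f' ≫ tick κ m' hm' := rfl
  change φ (tick (f.fn κ) m hm ≫ f)
  rw [e]
  exact hφ _ _ (h m' hm')

namespace Rel

/-- The relation that holds when `A` holds one tick of `κ` later. -/
def laterRel {W : World} (κ : Clk W) (A : Rel W) : Rel W where
  mem f M N := Later (f.fn κ) fun {_} t => A.mem (t ≫ f) (Pg.res t M) (Pg.res t N)
  stable {U V} g f M N h := by
    have := Later.stable g (f.fn κ) _ (fun {X X'} p k hk => by
      have := A.stable p (k ≫ f) _ _ hk
      rwa [← Pg.res_comp, ← Pg.res_comp, ← Category.assoc] at this) h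
    intro m hm
    have h1 := this m hm
    dsimp only at h1
    rw [Pg.res_comp, Pg.res_comp, Category.assoc] at h1
    exact h1

/-- The intersection of a clock-indexed family of relations. -/
def isectRel {W : World} (A : KFam W) : Rel W where
  mem {V} f M N := ∀ (U : World) (g : U ⟶ V) (κ : Clk U),
    (A.app (g ≫ f) κ).holds (Pg.res g M) (Pg.res g N)
  stable g f M N h U k κ := by
    rw [← Category.assoc, ← Pg.res_comp, ← Pg.res_comp]
    exact h U (k ≫ g) κ

/-- The product of a clock-indexed family of relations. -/
def kprodRel {W : World} (A : KFam W) : Rel W where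
  mem {V} f M N := ∀ (U : World) (g : U ⟶ V) (κ : Clk U),
    (A.app (g ≫ f) κ).holds (.kapp (Pg.res g M) κ) (.kapp (Pg.res g N) κ)
  stable g f M N h U k κ := by
    rw [← Category.assoc, ← Pg.res_comp, ← Pg.res_comp]
    exact h U (k ≫ g) κ

section Restriction

variable {V W : World} (f : V ⟶ W)

theorem natOp_res (Y : Rel W) : res f (natOp W Y) = natOp V (res f Y) := rfl

theorem sgRel_res (A : Rel W) (B : Fam W) :
    res f (sgRel A B) = sgRel (A.res f) (B.res f) := rfl

theorem piRel_res (A : Rel W) (B : Fam W) :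
    res f (piRel A B) = piRel (A.res f) (B.res f) := by
  ext; simp [res, piRel, Fam.res]

theorem wOp_res (A : Rel W) (B : Fam W) (Y : Rel W) :
    res f (wOp A B Y) = wOp (A.res f) (B.res f) (res f Y) := by
  ext; simp [res, wOp, Fam.res, valClo]

theorem eqRel_res (A : Rel W) (M N : Pg W.card 0) :
    res f (eqRel A M N) = eqRel (A.res f) (Pg.res f M) (Pg.res f N) := by
  ext; simp [res, eqRel, Pg.res_comp]

theorem laterRel_res (κ : Clk W) (A : Rel W) :
    res f (laterRel κ A) = laterRel (f.fn κ) (A.res f) := by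
  ext; simp [res, laterRel]

theorem isectRel_res (A : KFam W) : res f (isectRel A) = isectRel (A.res f) := by
  ext; simp [res, isectRel, KFam.res]

theorem kprodRel_res (A : KFam W) : res f (kprodRel A) = kprodRel (A.res f) := by
  ext; simp [res, kprodRel, KFam.res]

end Restriction

end Rel

/-! ## Candidate type systems -/

/-- Candidate type systems: subobjects of the product of the presheaf of closed programs and the
presheaf of relations on closed programs. -/
@[ext]
structure CTS where
  mem : ∀ {W : World}, Pg W.card 0 → Rel W → Prop
  stable : ∀ {V W : World} (f : V ⟶ W) (A : Pg W.card 0) (R : Rel W),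
    mem A R → mem (Pg.res f A) (R.res f)

namespace CTS

instance : PartialOrder CTS where
  le σ τ := ∀ (W : World) (A : Pg W.card 0) (R : Rel W), σ.mem A R → τ.mem A R
  le_refl _ _ _ _ h := h
  le_trans _ _ _ h k W A R hR := k W A R (h W A R hR)
  le_antisymm σ τ h k := by
    ext W A R; exact ⟨h W A R, k W A R⟩

instance : InfSet CTS where
  sInf 𝒮 :=
    { mem := fun A R => ∀ τ ∈ 𝒮, CTS.mem τ A R
      stable := fun f A R h τ hτ => τ.stable f A R (h τ hτ) }

instance : CompleteLattice CTS :=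
  completeLatticeOfInf CTS fun _ =>
    ⟨fun _ hτ _ _ _ h => h _ hτ, fun _ hτ W A R h _ hσ => hτ hσ W A R h⟩

/-- The union of two candidate type systems. -/
def union (σ τ : CTS) : CTS where
  mem A R := σ.mem A R ∨ τ.mem A R
  stable f A R h := h.imp (σ.stable f A R) (τ.stable f A R)

/-- The closure of a candidate type system under evaluation to canonical form. -/
def valClo (τ : CTS) : CTS where
  mem A R := ∃ A', Pg.Eval A A' ∧ τ.mem A' R
  stable f A R := by
    rintro ⟨A', hA, h⟩
    exact ⟨_, hA.map f.fn, τ.stable f _ _ h⟩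

/-- The family `B` of types over the relation `𝒜` is functional in `τ`, with meaning `ℬ`. -/
def Functional (τ : CTS) {W : World} (𝒜 : Rel W) (B : Pg W.card 1) (ℬ : Fam W) : Prop :=
  ∀ (V : World) (f : V ⟶ W) (M₀ M₁ : Pg V.card 0), 𝒜.mem f M₀ M₁ →
    τ.mem ((Pg.res f B).inst M₀) (ℬ.app f M₀) ∧ τ.mem ((Pg.res f B).inst M₁) (ℬ.app f M₀) ∧
    τ.mem ((Pg.res f B).inst M₁) (ℬ.app f M₁) ∧ τ.mem ((Pg.res f B).inst M₀) (ℬ.app f M₁)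

theorem Functional.res {τ : CTS} {V W : World} (f : V ⟶ W) {𝒜 : Rel W} {B : Pg W.card 1}
    {ℬ : Fam W} (h : Functional τ 𝒜 B ℬ) :
    Functional τ (𝒜.res f) (Pg.res f B) (ℬ.res f) := by
  intro U g M₀ M₁ hM
  rw [← Pg.res_comp]
  exact h U (g ≫ f) M₀ M₁ hM

theorem Functional.mono {σ τ : CTS} (hστ : σ ≤ τ) {W : World} {𝒜 : Rel W} {B : Pg W.card 1}
    {ℬ : Fam W} (h : Functional σ 𝒜 B ℬ) : Functional τ 𝒜 B ℬ := fun V f M₀ M₁ hM =>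
  have k := h V f M₀ M₁ hM
  ⟨hστ _ _ _ k.1, hστ _ _ _ k.2.1, hστ _ _ _ k.2.2.1, hστ _ _ _ k.2.2.2⟩

/-- The empty type. -/
def cloVoid : CTS where
  mem {W} T X := T = .void ∧ X = Rel.emptyRel W
  stable f A R := by rintro ⟨rfl, rfl⟩; exact ⟨rfl, rfl⟩

/-- The unit type. -/
def cloUnit : CTS where
  mem {W} T X := T = .unit ∧ X = (Rel.unitRel W).valClo
  stable f A R := by rintro ⟨rfl, rfl⟩; exact ⟨rfl, rfl⟩

/-- The type of booleans. -/
def cloBool : CTS where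
  mem {W} T X := T = .bool ∧ X = (Rel.boolRel W).valClo
  stable f A R := by rintro ⟨rfl, rfl⟩; exact ⟨rfl, rfl⟩

/-- The type of natural numbers. -/
def cloNat : CTS where
  mem {W} T X := T = .nat ∧ X = (Rel.natOp W).lfp.valClo
  stable f A R := by
    rintro ⟨rfl, rfl⟩
    refine ⟨rfl, ?_⟩
    rw [Rel.valClo_res, Rel.lfp_res f _ _ (Rel.natOp_res f)]

/-- Dependent pair types. -/
def cloSg (τ : CTS) : CTS where
  mem {W} T X := ∃ (A : Pg W.card 0) (B : Pg W.card 1) (𝒜 : Rel W) (ℬ : Fam W), T = .sg A B ∧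
    τ.mem A 𝒜 ∧ Functional τ 𝒜 B ℬ ∧ X = Rel.sgRel 𝒜 ℬ
  stable f T X := by
    rintro ⟨A, B, 𝒜, ℬ, rfl, hA, hB, rfl⟩
    exact ⟨_, _, _, _, rfl, τ.stable f _ _ hA, hB.res f, Rel.sgRel_res f _ _⟩

/-- Dependent function types. -/
def cloPi (τ : CTS) : CTS where
  mem {W} T X := ∃ (A : Pg W.card 0) (B : Pg W.card 1) (𝒜 : Rel W) (ℬ : Fam W), T = .pi A B ∧
    τ.mem A 𝒜 ∧ Functional τ 𝒜 B ℬ ∧ X = Rel.piRel 𝒜 ℬ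
  stable f T X := by
    rintro ⟨A, B, 𝒜, ℬ, rfl, hA, hB, rfl⟩
    exact ⟨_, _, _, _, rfl, τ.stable f _ _ hA, hB.res f, Rel.piRel_res f _ _⟩

/-- Types of well-founded trees. -/
def cloW (τ : CTS) : CTS where
  mem {W} T X := ∃ (A : Pg W.card 0) (B : Pg W.card 1) (𝒜 : Rel W) (ℬ : Fam W), T = .wty A B ∧
    τ.mem A 𝒜 ∧ Functional τ 𝒜 B ℬ ∧ X = (Rel.wOp 𝒜 ℬ).lfp.valClo
  stable f T X := by
    rintro ⟨A, B, 𝒜, ℬ, rfl, hA, hB, rfl⟩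
    refine ⟨_, _, _, _, rfl, τ.stable f _ _ hA, hB.res f, ?_⟩
    rw [Rel.valClo_res, Rel.lfp_res f _ _ (Rel.wOp_res f 𝒜 ℬ)]

/-- Extensional equality types. -/
def cloEq (τ : CTS) : CTS where
  mem {W} T X := ∃ (A M₀ M₁ : Pg W.card 0) (𝒜 : Rel W), T = .eqty A M₀ M₁ ∧
    τ.mem A 𝒜 ∧ 𝒜.holds M₀ M₀ ∧ 𝒜.holds M₁ M₁ ∧ X = (Rel.eqRel 𝒜 M₀ M₁).valClo
  stable f T X := by
    rintro ⟨A, M₀, M₁, 𝒜, rfl, hA, h₀, h₁, rfl⟩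
    refine ⟨_, _, _, _, rfl, τ.stable f _ _ hA, ?_, ?_, ?_⟩
    · exact (Rel.holds_res _ _ _ _).2 (Rel.holds_stable f _ h₀)
    · exact (Rel.holds_res _ _ _ _).2 (Rel.holds_stable f _ h₁)
    · rw [Rel.valClo_res, Rel.eqRel_res]; rfl

/-- Later modalities. -/
def cloLater (τ : CTS) : CTS where
  mem {W} T X := ∃ (κ : Clk W) (A : Pg W.card 0) (𝒜 : Rel W), T = .later κ A ∧
    (Later κ fun {_} t => τ.mem (Pg.res t A) (𝒜.res t)) ∧ X = Rel.laterRel κ 𝒜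
  stable f T X := by
    rintro ⟨κ, A, 𝒜, rfl, hA, rfl⟩
    refine ⟨_, _, _, rfl, ?_, Rel.laterRel_res f _ _⟩
    have h := Later.stable f κ _ (fun g k hk => by
      have := τ.stable g _ _ hk
      rwa [← Pg.res_comp, ← Rel.res_comp] at this) hA
    intro m hm
    have h1 := h m hm
    dsimp only at h1
    rw [Pg.res_comp, Rel.res_comp] at h1
    exact h1

/-- Clock intersection types. -/
def cloIsect (τ : CTS) : CTS where
  mem {W} T X := ∃ (A : Pg (W.card + 1) 0) (𝒜 : KFam W), T = .kisect A ∧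
    (∀ (V : World) (f : V ⟶ W) (κ : Clk V), τ.mem (Pg.at_ f κ A) (𝒜.app f κ)) ∧
    X = Rel.isectRel 𝒜
  stable f T X := by
    rintro ⟨A, 𝒜, rfl, hA, rfl⟩
    refine ⟨_, 𝒜.res f, rfl, fun V g κ => ?_, Rel.isectRel_res f _⟩
    rw [← Pg.at_res]
    exact hA V (g ≫ f) κ

/-- Clock product types. -/
def cloKProd (τ : CTS) : CTS where
  mem {W} T X := ∃ (A : Pg (W.card + 1) 0) (𝒜 : KFam W), T = .kprod A ∧
    (∀ (V : World) (f : V ⟶ W) (κ : Clk V), τ.mem (Pg.at_ f κ A) (𝒜.app f κ)) ∧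
    X = Rel.kprodRel 𝒜
  stable f T X := by
    rintro ⟨A, 𝒜, rfl, hA, rfl⟩
    refine ⟨_, 𝒜.res f, rfl, fun V g κ => ?_, Rel.kprodRel_res f _⟩
    rw [← Pg.at_res]
    exact hA V (g ≫ f) κ

/-- All connectives other than universes. -/
def conns (τ : CTS) : CTS :=
  cloVoid.union <| cloUnit.union <| cloBool.union <| cloNat.union <| (cloSg τ).union <|
    (cloPi τ).union <| (cloKProd τ).union <| (cloEq τ).union <| (cloLater τ).union <|
      (cloIsect τ).union (cloW τ)

theorem conns_mono {σ τ : CTS} (h : σ ≤ τ) : conns σ ≤ conns τ := by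
  intro W T X
  refine Or.imp id <| Or.imp id <| Or.imp id <| Or.imp id <| Or.imp ?_ <| Or.imp ?_ <|
    Or.imp ?_ <| Or.imp ?_ <| Or.imp ?_ <| Or.imp ?_ ?_
  · rintro ⟨A, B, 𝒜, ℬ, e, hA, hB, e'⟩
    exact ⟨A, B, 𝒜, ℬ, e, h _ _ _ hA, hB.mono h, e'⟩
  · rintro ⟨A, B, 𝒜, ℬ, e, hA, hB, e'⟩
    exact ⟨A, B, 𝒜, ℬ, e, h _ _ _ hA, hB.mono h, e'⟩
  · rintro ⟨A, 𝒜, e, hA, e'⟩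
    exact ⟨A, 𝒜, e, fun V f κ => h _ _ _ (hA V f κ), e'⟩
  · rintro ⟨A, M₀, M₁, 𝒜, e, hA, h'⟩
    exact ⟨A, M₀, M₁, 𝒜, e, h _ _ _ hA, h'⟩
  · rintro ⟨κ, A, 𝒜, e, hA, e'⟩
    exact ⟨κ, A, 𝒜, e, fun m hm => h _ _ _ (hA m hm), e'⟩
  · rintro ⟨A, 𝒜, e, hA, e'⟩
    exact ⟨A, 𝒜, e, fun V f κ => h _ _ _ (hA V f κ), e'⟩
  · rintro ⟨A, B, 𝒜, ℬ, e, hA, hB, e'⟩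
    exact ⟨A, B, 𝒜, ℬ, e, h _ _ _ hA, hB.mono h, e'⟩

/-- The operator that extends a type system, over the base `σ`, by all connectives other than
universes. -/
def tsFun (σ : CTS) : CTS →o CTS where
  toFun τ := σ.union (valClo (conns τ))
  monotone' _ _ h _ _ _ := Or.imp id fun ⟨A', hA, k⟩ => ⟨A', hA, conns_mono h _ _ _ k⟩

/-- The closure of a candidate type system under all connectives other than universes. -/
def tsClose (σ : CTS) : CTS := (tsFun σ).lfp

/-- `τ ⊨ A ∼ B type` at the world `W`. -/
def SimType (τ : CTS) {W : World} (A B : Pg W.card 0) : Prop :=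
  ∃ 𝒜 : Rel W, τ.mem A 𝒜 ∧ τ.mem B 𝒜

/-- `τ ⊨ M₀ ∼ M₁ ∈ A` at the world `W`. -/
def SimMem (τ : CTS) {W : World} (M₀ M₁ A : Pg W.card 0) : Prop :=
  ∃ 𝒜 : Rel W, τ.mem A 𝒜 ∧ 𝒜.holds M₀ M₁

/-- The relation `{(A₀, A₁) | τ ⊨ A₀ ∼ A₁ type}`. -/
def univRel (τ : CTS) (W : World) : Rel W where
  mem _ A₀ A₁ := τ.SimType A₀ A₁
  stable g _ _ _ := fun ⟨𝒜, h₀, h₁⟩ => ⟨𝒜.res g, τ.stable g _ _ h₀, τ.stable g _ _ h₁⟩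

/-- The candidate type system of the universes `𝒰 i` with `i < n`, where `𝒰 i` classifies the types
of `τ i`. -/
def univSys (n : ℕ) (τ : ∀ i < n, CTS) : CTS where
  mem {W} T X := ∃ (i : ℕ) (hi : i < n), T = .univ i ∧ X = univRel (τ i hi) W
  stable f T X := by rintro ⟨i, hi, rfl, rfl⟩; exact ⟨i, hi, rfl, rfl⟩

/-- The spine of the universe hierarchy: at level `n`, the programs that evaluate to a universe
`𝒰 i` with `i < n`, where `𝒰 i` classifies the types of the closure of the spine at level `i`. -/
def spine (n : ℕ) : CTS := valClo (univSys n fun i _ => tsClose (spine i))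
termination_by n

/-- The type system at level `n` of the hierarchy. -/
def tower (n : ℕ) : CTS := tsClose (spine n)

/-- The join of the whole hierarchy. -/
def omega : CTS where
  mem A R := ∃ n, (tower n).mem A R
  stable f A R := fun ⟨n, h⟩ => ⟨n, (tower n).stable f A R h⟩

/-- Similarity `γ₀ ∼ γ₁ : Γ` of instantiations of a telescope. -/
def SimEnv (τ : CTS) {W : World} : {n : ℕ} → Tl W.card n → (γ₀ γ₁ : Fin n → Pg W.card 0) → Prop
  | _, .nil, _, _ => True
  | _, .snoc Γ A, γ₀, γ₁ =>
      SimEnv τ Γ (γ₀ ∘ Fin.succ) (γ₁ ∘ Fin.succ) ∧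
      τ.SimMem (γ₀ 0) (γ₁ 0) (A.subst (γ₀ ∘ Fin.succ))

/-- Open type similarity `Γ ≫ A₀ ∼ A₁ type` at the world `W`. -/
def HypSimType (τ : CTS) {W : World} {n : ℕ} (Γ : Tl W.card n) (A₀ A₁ : Pg W.card n) : Prop :=
  ∀ (V : World) (f : V ⟶ W) (γ₀ γ₁ : Fin n → Pg V.card 0), τ.SimEnv (Γ.res f) γ₀ γ₁ →
    τ.SimType ((Pg.res f A₀).subst γ₀) ((Pg.res f A₁).subst γ₁)

/-- Open member similarity `Γ ≫ M₀ ∼ M₁ ∈ A` at the world `W`. -/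
def HypSimMem (τ : CTS) {W : World} {n : ℕ} (Γ : Tl W.card n) (M₀ M₁ A : Pg W.card n) : Prop :=
  ∀ (V : World) (f : V ⟶ W) (γ₀ γ₁ : Fin n → Pg V.card 0), τ.SimEnv (Γ.res f) γ₀ γ₁ →
    τ.SimMem ((Pg.res f M₀).subst γ₀) ((Pg.res f M₁).subst γ₁) ((Pg.res f A).subst γ₀)

/-- Context validity at the world `W`. -/
def IsCtx (τ : CTS) {W : World} : {n : ℕ} → Tl W.card n → Prop
  | _, .nil => True
  | _, .snoc Γ A => IsCtx τ Γ ∧ τ.HypSimType Γ A A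

end CTS

/-- The world `W` forces the meaning of the judgment `Δ | Γ ≫ M₀ = M₁ ∈ A`: for every environment
`ϱ` of clocks, if `⟦Γ⟧ϱ` is a context and `⟦A⟧ϱ` is a type over it, then `⟦M₀⟧ϱ` and `⟦M₁⟧ϱ` are
similar elements of it. -/
def EqMem (W : World) {Δ n : ℕ} (Γ : Ctx Δ n) (M₀ M₁ A : Fm Δ n) : Prop :=
  ∀ (V : World) (_ : V ⟶ W) (ϱ : Fin Δ → Clk V),
    CTS.omega.IsCtx (Γ.interp ϱ) →
    CTS.omega.HypSimType (Γ.interp ϱ) (A.interp ϱ) (A.interp ϱ) →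
    CTS.omega.HypSimMem (Γ.interp ϱ) (M₀.interp ϱ) (M₁.interp ϱ) (A.interp ϱ)

end GCTT

/-!
The fixed point rule holds by Löb induction in the presheaf topos: after a tick of the clock `κ` less
time is left on it, so a statement about all worlds may assume itself one tick later
(`GCTT.Rel.loeb`). For `fix x. M` this says that the fixed points are similar at `▷_κ A`, so the
typing of `M` over `x : ▷_κ A` shows that their unfoldings are similar at `A`
(`GCTT.CTS.hypSimMem_fix`).

Two properties of the type systems make this argument go through. The induction hypothesis supplies
some relation for `A` after a tick, and it has to be the restriction of the one at hand: each type
has at most one relation (`GCTT.CTS.omega_agree`). The unfoldings have to be folded again: the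
relation of each type is closed under expansion of either side along the operational semantics
(`GCTT.CTS.omega_headClosed`). Both are proved by induction on the least fixed point that defines
the closure under the connectives, the second from the first.

For the combinator `λ f. fix x. f x` the judgment presupposes only that `(▷_κ A → A) → A` is a type,
from which it does not follow that `A` is one. At given similar functions `f`, however, the codomain
`A` is a type, because the outer function type is functional over its domain, and Löb induction
applies to the fixed points of these functions (`GCTT.CTS.holds_fix_app`).
-/

namespace GCTT

/-! ### Substitution -/

namespace Pg

theorem up_comp_lift {c n m l : ℕ} (γ : Fin m → Pg c l) (r : Fin n → Fin m) :
    up γ ∘ lift r = up (γ ∘ r) := by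
  funext i; induction i using Fin.cases <;> rfl

theorem subst_rename {c n : ℕ} (M : Pg c n) : ∀ {m l : ℕ} (γ : Fin m → Pg c l) (r : Fin n → Fin m),
    (M.rename r).subst γ = M.subst (γ ∘ r) := by
  induction M <;> intros <;> simp only [rename, subst, up_comp_lift, Function.comp_assoc,
    Function.comp_apply, *]

theorem rename_rename {c n : ℕ} (M : Pg c n) : ∀ {m l : ℕ} (s : Fin m → Fin l) (r : Fin n → Fin m),
    (M.rename r).rename s = M.rename (s ∘ r) := by
  induction M <;> intros <;> simp only [rename, lift_comp, Function.comp_apply, *]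

theorem rename_comp_up {c n m l : ℕ} (r : Fin m → Fin l) (γ : Fin n → Pg c m) :
    rename (lift r) ∘ up γ = up (rename r ∘ γ) := by
  funext i
  induction i using Fin.cases
  · rfl
  · simp only [up, Function.comp_apply, ext_succ, rename_rename]; rfl

theorem rename_subst {c n : ℕ} (M : Pg c n) : ∀ {m l : ℕ} (r : Fin m → Fin l) (γ : Fin n → Pg c m),
    (M.subst γ).rename r = M.subst (rename r ∘ γ) := by
  have key : ∀ {c n m l : ℕ} (r : Fin m → Fin l) (γ : Fin n → Pg c m),
      rename r ∘ mapClk Fin.succ ∘ γ = mapClk Fin.succ ∘ rename r ∘ γ := by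
    intros; funext i; simp only [Function.comp, rename_mapClk]
  induction M <;> intros <;> simp only [rename, subst, rename_comp_up, Function.comp_apply, *]

theorem subst_comp_up {c n m l : ℕ} (δ : Fin m → Pg c l) (γ : Fin n → Pg c m) :
    subst (up δ) ∘ up γ = up (subst δ ∘ γ) := by
  funext i
  induction i using Fin.cases
  · rfl
  · simp only [up, Function.comp_apply, ext_succ, subst_rename, rename_subst]; rfl

theorem subst_subst {c n : ℕ} (M : Pg c n) : ∀ {m l : ℕ} (δ : Fin m → Pg c l) (γ : Fin n → Pg c m),
    (M.subst γ).subst δ = M.subst (subst δ ∘ γ) := by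
  have key : ∀ {c n m l : ℕ} (δ : Fin m → Pg c l) (γ : Fin n → Pg c m),
      subst (mapClk Fin.succ ∘ δ) ∘ mapClk Fin.succ ∘ γ = mapClk Fin.succ ∘ subst δ ∘ γ := by
    intros; funext i; simp only [Function.comp_apply, subst_mapClk]
  induction M <;> intros <;> simp only [subst, subst_comp_up, Function.comp_apply, *]

theorem up_var (c n : ℕ) : up (var : Fin n → Pg c n) = var := by
  funext i; induction i using Fin.cases <;> rfl

theorem subst_var {c n : ℕ} (M : Pg c n) : M.subst var = M := by
  have key : ∀ {c n : ℕ}, mapClk Fin.succ ∘ (var : Fin n → Pg c n) = var := rfl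
  induction M <;> simp only [subst, up_var, *]

theorem inst_weaken {c n : ℕ} (M N : Pg c n) : (M.rename Fin.succ).inst N = M := by
  rw [inst, subst_rename]; exact subst_var M

/-- Instantiating the variable under a substitution `up γ` amounts to extending `γ`. -/
theorem inst_subst_up {c n m : ℕ} (M : Pg c (n + 1)) (γ : Fin n → Pg c m) (N : Pg c m) :
    (M.subst (up γ)).inst N = M.subst (ext γ N) := by
  rw [inst, subst_subst]; congr 1
  funext i
  induction i using Fin.cases
  · rfl
  · exact inst_weaken _ _

theorem res_subst {V W : World} (f : V ⟶ W) {n m : ℕ} (M : Pg W.card n)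
    (γ : Fin n → Pg W.card m) : res f (M.subst γ) = (res f M).subst (res f ∘ γ) :=
  subst_mapClk M f.fn γ

/-! ### Evaluation is deterministic -/

theorem Val.not_step {c : ℕ} {M N : Pg c 0} (h : Val M) : ¬ Step M N := by
  intro k; cases h <;> cases k

theorem Step.det {c : ℕ} {M N N' : Pg c 0} (h : Step M N) (k : Step M N') : N = N' := by
  induction h generalizing N' with
  | app _ h ih | kapp _ h ih | fst h ih | snd h ih | ite _ _ h ih | ifze _ _ h ih | wrec _ h ih =>
    cases k <;> first
      | (rename_i k; rw [ih k])
      | exact absurd h (Val.not_step (by constructor))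
  | _ =>
    cases k <;> first
      | rfl
      | (rename_i k; exact absurd k (Val.not_step (by constructor)))

theorem Val.eq_of_steps {c : ℕ} {M N : Pg c 0} (h : Val M) (k : Relation.ReflTransGen Step M N) :
    N = M := by
  rcases k.cases_head with rfl | ⟨_, k, _⟩
  · rfl
  · exact absurd k h.not_step

theorem Eval.det {c : ℕ} {M N N' : Pg c 0} (h : Eval M N) (k : Eval M N') : N = N' := by
  obtain ⟨h, hN⟩ := h
  induction h using Relation.ReflTransGen.head_induction_on with
  | refl => exact (hN.eq_of_steps k.1).symm
  | head s _ ih =>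
    rcases k.1.cases_head with rfl | ⟨_, s', k'⟩
    · exact absurd s k.2.not_step
    · obtain rfl := s.det s'
      exact ih ⟨k', k.2⟩

theorem Val.eval {c : ℕ} {M : Pg c 0} (h : Val M) : Eval M M := ⟨.refl, h⟩

theorem Eval.head {c : ℕ} {M M' N : Pg c 0} (h : Relation.ReflTransGen Step M M')
    (k : Eval M' N) : Eval M N := ⟨h.trans k.1, k.2⟩

theorem steps_res {V W : World} (f : V ⟶ W) {M N : Pg W.card 0}
    (h : Relation.ReflTransGen Step M N) : Relation.ReflTransGen Step (res f M) (res f N) :=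
  h.lift _ fun _ _ s => s.map f.fn

end Pg

/-! ### Elaboration commutes with weakening -/

theorem Fm.interp_rename {Δ n : ℕ} (M : Fm Δ n) : ∀ {m c : ℕ} (r : Fin n → Fin m)
    (ϱ : Fin Δ → Fin c), (M.rename r).interp ϱ = (M.interp ϱ).rename r := by
  induction M <;> intros <;> simp only [Fm.rename, Fm.interp, Pg.rename, *]

theorem Rel.res_id {W : World} (R : Rel W) : R.res (𝟙 W) = R := by
  ext; simp [Rel.res]

namespace CTS

/-! ### Uniqueness of the relation of a type -/

/-- `▷_κ 𝒜` depends only on the restriction of `𝒜` along one tick of `κ`, because every later tick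
factors through it. -/
theorem laterRel_congr {W : World} {κ : Clk W} {𝒜 𝒜' : Rel W}
    (h : Later κ fun {_} t => 𝒜.res t = 𝒜'.res t) : Rel.laterRel κ 𝒜 = Rel.laterRel κ 𝒜' := by
  have h' : ∀ {V : World} (f : V ⟶ W), Later (f.fn κ) fun {_} t => 𝒜.res (t ≫ f) = 𝒜'.res (t ≫ f) :=
    fun f => Later.stable f κ _
      (fun g k hk => by rw [Rel.res_comp, Rel.res_comp]; exact congrArg _ hk) h
  ext V f M N
  refine forall_congr' fun m => forall_congr' fun hm => ?_
  have := h' f m hm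
  dsimp only at this ⊢
  rw [← Rel.holds_res, ← Rel.holds_res]
  rw [this]

/-- The relations of `σ` and `τ` agree on every type that belongs to both. -/
def Agree (σ τ : CTS) : Prop :=
  ∀ ⦃W : World⦄ ⦃A : Pg W.card 0⦄ ⦃R R' : Rel W⦄, σ.mem A R → τ.mem A R' → R = R'

/-- Two meanings of a functional family agree on the field of the index relation, which is all that
the connectives use of them. -/
theorem Agree.fam {σ τ : CTS} (h : Agree σ τ) {W : World} {𝒜 : Rel W} {B : Pg W.card 1}
    {ℬ ℬ' : Fam W} (hB : σ.Functional 𝒜 B ℬ) (hB' : τ.Functional 𝒜 B ℬ') {V : World} (f : V ⟶ W)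
    {M N : Pg V.card 0} (hM : 𝒜.mem f M N) : ℬ.app f M = ℬ'.app f M :=
  h (hB V f M N hM).1 (hB' V f M N hM).1

theorem conns_agree {σ τ : CTS} (h : Agree σ τ) : Agree (conns σ) (conns τ) := by
  rintro W T R R' hR hR'
  rcases hR with ⟨rfl, rfl⟩ | ⟨rfl, rfl⟩ | ⟨rfl, rfl⟩ | ⟨rfl, rfl⟩ | ⟨A, B, 𝒜, ℬ, rfl, hA, hB, rfl⟩ |
    ⟨A, B, 𝒜, ℬ, rfl, hA, hB, rfl⟩ | ⟨A, 𝒜, rfl, hA, rfl⟩ | ⟨A, M₀, M₁, 𝒜, rfl, hA, -, -, rfl⟩ |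
    ⟨κ, A, 𝒜, rfl, hA, rfl⟩ | ⟨A, 𝒜, rfl, hA, rfl⟩ | ⟨A, B, 𝒜, ℬ, rfl, hA, hB, rfl⟩ <;>
  rcases hR' with ⟨e, rfl⟩ | ⟨e, rfl⟩ | ⟨e, rfl⟩ | ⟨e, rfl⟩ | ⟨A', B', 𝒜', ℬ', e, hA', hB', rfl⟩ |
    ⟨A', B', 𝒜', ℬ', e, hA', hB', rfl⟩ | ⟨A', 𝒜', e, hA', rfl⟩ |
    ⟨A', M₀', M₁', 𝒜', e, hA', -, -, rfl⟩ | ⟨κ', A', 𝒜', e, hA', rfl⟩ | ⟨A', 𝒜', e, hA', rfl⟩ |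
    ⟨A', B', 𝒜', ℬ', e, hA', hB', rfl⟩ <;> cases e
  iterate 4 rfl
  · obtain rfl := h hA hA'
    ext V f M N
    refine and_congr_right fun hM => ?_
    rw [h.fam hB hB' f hM]
  · obtain rfl := h hA hA'
    ext V f M N
    refine forall_congr' fun U => forall_congr' fun g => forall_congr' fun O =>
      forall_congr' fun P => forall_congr' fun hO => ?_
    rw [h.fam hB hB' _ hO]
  · have : 𝒜 = 𝒜' := by
      refine KFam.ext ?_
      funext V f κ
      exact h (hA V f κ) (hA' V f κ)
    rw [this]
  · rw [h hA hA']
  · exact laterRel_congr fun m hm => h (hA m hm) (hA' m hm)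
  · have : 𝒜 = 𝒜' := by
      refine KFam.ext ?_
      funext V f κ
      exact h (hA V f κ) (hA' V f κ)
    rw [this]
  · obtain rfl := h hA hA'
    have : Rel.wOp 𝒜 ℬ = Rel.wOp 𝒜 ℬ' := by
      ext Y V f M N
      refine exists_congr fun M₀ => exists_congr fun N₀ => exists_congr fun M₁ =>
        exists_congr fun N₁ => and_congr_right fun _ => and_congr_right fun _ =>
        and_congr_right fun hM => forall_congr' fun U => forall_congr' fun g => ?_
      rw [h.fam hB hB' _ (𝒜.stable g f _ _ hM)]
    rw [this]

theorem spine_mem {n : ℕ} {W : World} {A : Pg W.card 0} {R : Rel W} :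
    (spine n).mem A R ↔ ∃ i < n, Pg.Eval A (.univ i) ∧ R = univRel (tower i) W := by
  rw [spine]
  constructor
  · rintro ⟨_, hA, i, hi, rfl, rfl⟩
    exact ⟨i, hi, hA, rfl⟩
  · rintro ⟨i, hi, hA, rfl⟩
    exact ⟨_, hA, i, hi, rfl, rfl⟩

theorem tsClose_mem {σ : CTS} {W : World} {A : Pg W.card 0} {R : Rel W} :
    (tsClose σ).mem A R ↔ σ.mem A R ∨ ∃ A', Pg.Eval A A' ∧ (conns (tsClose σ)).mem A' R := by
  conv_lhs => rw [tsClose, ← OrderHom.map_lfp]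
  rfl

theorem conns_ne_univ {τ : CTS} {W : World} {R : Rel W} {i : ℕ} :
    ¬ (conns τ).mem (.univ i : Pg W.card 0) R := by
  rintro (⟨e, -⟩ | ⟨e, -⟩ | ⟨e, -⟩ | ⟨e, -⟩ | ⟨_, _, _, _, e, -⟩ | ⟨_, _, _, _, e, -⟩ |
    ⟨_, _, e, -⟩ | ⟨_, _, _, _, e, -⟩ | ⟨_, _, _, e, -⟩ | ⟨_, _, e, -⟩ | ⟨_, _, _, _, e, -⟩) <;>
  cases e

/-- Each type of the system at level `n` has exactly one relation. -/
theorem tower_agree (n : ℕ) : Agree (tower n) (tower n) := by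
  -- The pairs whose relation is the only one possible, at all worlds; the hierarchy is the least
  -- fixed point, so it suffices that they are closed under the generating operator.
  let S : CTS :=
    { mem := fun {W} A R => ∀ (V : World) (f : V ⟶ W) (R' : Rel V),
        (tower n).mem (Pg.res f A) R' → R.res f = R'
      stable := by
        intro V W f A R h U g R' hR'
        rw [← Rel.res_comp]
        rw [← Pg.res_comp] at hR'
        exact h U _ R' hR' }
  have hS : Agree S (tower n) := by
    intro W A R R' hR hR'
    rw [← R.res_id]
    exact hR W _ R' (by rwa [Pg.res_id])
  have key : Agree (tsFun (spine n) S) (tower n) := by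
    rintro W A R R' hR hR'
    rw [tower, tsClose_mem] at hR'
    rcases hR with hR | ⟨A₁, hA₁, hR⟩ <;> rcases hR' with hR' | ⟨A₂, hA₂, hR'⟩
    · obtain ⟨i, -, hA, rfl⟩ := spine_mem.1 hR
      obtain ⟨j, -, hA', rfl⟩ := spine_mem.1 hR'
      cases hA.det hA'
      rfl
    · obtain ⟨i, -, hA, rfl⟩ := spine_mem.1 hR
      cases hA.det hA₂
      exact absurd hR' conns_ne_univ
    · obtain ⟨i, -, hA, rfl⟩ := spine_mem.1 hR'
      cases hA.det hA₁
      exact absurd hR conns_ne_univ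
    · cases hA₁.det hA₂
      exact conns_agree hS hR hR'
  have : tower n ≤ S := (tsFun (spine n)).lfp_le fun W A R hR V f R' hR' =>
    key ((tsFun (spine n) S).stable f A R hR) hR'
  exact fun W A R R' hR hR' => hS (this W A R hR) hR'

theorem tower_mono : Monotone tower := by
  intro m n hmn
  refine OrderHom.lfp.monotone fun τ W A R => Or.imp_left fun h => ?_
  obtain ⟨i, hi, h⟩ := spine_mem.1 h
  exact spine_mem.2 ⟨i, hi.trans_le hmn, h⟩

theorem omega_agree : Agree omega omega := by
  rintro W A R R' ⟨m, hR⟩ ⟨n, hR'⟩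
  exact tower_agree (max m n) (tower_mono (le_max_left m n) _ _ _ hR)
    (tower_mono (le_max_right m n) _ _ _ hR')

end CTS

/-! ### Closure under head expansion -/

/-- The relation `R` is closed under expansion of either side along the operational semantics. -/
def Rel.HeadClosed {W : World} (R : Rel W) : Prop :=
  ∀ ⦃V : World⦄ (f : V ⟶ W) ⦃M M' N N' : Pg V.card 0⦄, Relation.ReflTransGen Pg.Step M M' →
    Relation.ReflTransGen Pg.Step N N' → R.mem f M' N' → R.mem f M N

theorem Rel.HeadClosed.res {V W : World} (f : V ⟶ W) {R : Rel W} (h : R.HeadClosed) :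
    (R.res f).HeadClosed := fun _ g _ _ _ _ hM hN hR => h (g ≫ f) hM hN hR

theorem Rel.valClo_headClosed {W : World} (R : Rel W) : R.valClo.HeadClosed := by
  rintro V f M M' N N' hM hN ⟨M₁, N₁, hM₁, hN₁, hR⟩
  exact ⟨M₁, N₁, hM₁.head hM, hN₁.head hN, hR⟩

namespace CTS

theorem tower_head {n : ℕ} {W : World} {A A' : Pg W.card 0} {R : Rel W}
    (h : Relation.ReflTransGen Pg.Step A A') (hA : (tower n).mem A' R) : (tower n).mem A R := by
  rw [tower, tsClose_mem] at hA ⊢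
  rcases hA with hA | ⟨B, hB, hA⟩
  · obtain ⟨i, hi, hA, hR⟩ := spine_mem.1 hA
    exact .inl (spine_mem.2 ⟨i, hi, hA.head h, hR⟩)
  · exact .inr ⟨B, hB.head h, hA⟩

/-- The connectives preserve closure under head expansion. The case of pairs uses uniqueness: the
second component is compared at the relation selected by the first one. -/
theorem conns_headClosed {τ : CTS} (hτ : Agree τ τ)
    {σ : CTS} (hστ : σ ≤ τ) (hσ : ∀ ⦃W : World⦄ ⦃A : Pg W.card 0⦄ ⦃R : Rel W⦄, σ.mem A R → R.HeadClosed)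
    {W : World} {T : Pg W.card 0} {R : Rel W} (hR : (conns σ).mem T R) : R.HeadClosed := by
  have steps : ∀ {c : ℕ} (F : Pg c 0 → Pg c 0) (_ : ∀ M N, Pg.Step M N → Pg.Step (F M) (F N))
      {M N : Pg c 0}, Relation.ReflTransGen Pg.Step M N → Relation.ReflTransGen Pg.Step (F M) (F N) :=
    fun F hF _ _ h => h.lift F hF
  rcases hR with ⟨rfl, rfl⟩ | ⟨rfl, rfl⟩ | ⟨rfl, rfl⟩ | ⟨rfl, rfl⟩ | ⟨A, B, 𝒜, ℬ, rfl, hA, hB, rfl⟩ |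
    ⟨A, B, 𝒜, ℬ, rfl, hA, hB, rfl⟩ | ⟨A, 𝒜, rfl, hA, rfl⟩ | ⟨A, M₀, M₁, 𝒜, rfl, hA, -, -, rfl⟩ |
    ⟨κ, A, 𝒜, rfl, hA, rfl⟩ | ⟨A, 𝒜, rfl, hA, rfl⟩ | ⟨A, B, 𝒜, ℬ, rfl, hA, hB, rfl⟩
  · rintro V f M M' N N' - - ⟨⟩
  iterate 3 exact Rel.valClo_headClosed _
  · rintro V f M M' N N' hM hN ⟨h, k⟩
    have hM₁ := steps .fst (fun _ _ => .fst) hM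
    have hN₁ := steps .fst (fun _ _ => .fst) hN
    have h₀ := hσ hA f hM₁ hN₁ h
    have h₁ := hσ hA f .refl hN₁ h
    refine ⟨h₀, ?_⟩
    -- `fst M` and `fst M'` are both related to `fst N`, so that they select the same relation.
    have e : ℬ.app f (.fst M) = ℬ.app f (.fst M') :=
      hτ (hστ _ _ _ (hB V f _ _ h₀).2.1) (hστ _ _ _ (hB V f _ _ h₁).2.1)
    rw [e]
    exact hσ (hB V f _ _ h₁).1 _ (steps .snd (fun _ _ => .snd) hM)
      (steps .snd (fun _ _ => .snd) hN) k
  · intro V f M M' N N' hM hN h U g O P hO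
    exact hσ (hB U (g ≫ f) _ _ hO).1 _
      (steps (.app · O) (fun _ _ => .app O) (Pg.steps_res g hM))
      (steps (.app · P) (fun _ _ => .app P) (Pg.steps_res g hN)) (h U g O P hO)
  · intro V f M M' N N' hM hN h U g κ
    exact hσ (hA U (g ≫ f) κ) _
      (steps (.kapp · κ) (fun _ _ => .kapp κ) (Pg.steps_res g hM))
      (steps (.kapp · κ) (fun _ _ => .kapp κ) (Pg.steps_res g hN)) (h U g κ)
  · exact Rel.valClo_headClosed _
  · intro V f M M' N N' hM hN h
    have h' := Later.stable f κ (fun {_} t => (𝒜.res t).HeadClosed)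
      (fun g k hk => by rw [Rel.res_comp]; exact hk.res g) (fun m hm => hσ (hA m hm))
    intro m hm
    have h₁ := h' m hm (𝟙 _) (Pg.steps_res (tick _ m hm) hM) (Pg.steps_res (tick _ m hm) hN)
    simp only [Rel.res, Category.id_comp] at h₁
    exact h₁ (h m hm)
  · intro V f M M' N N' hM hN h U g κ
    exact hσ (hA U (g ≫ f) κ) _ (Pg.steps_res g hM) (Pg.steps_res g hN) (h U g κ)
  · exact Rel.valClo_headClosed _

theorem tower_headClosed (n : ℕ) {W : World} {A : Pg W.card 0} {R : Rel W}
    (hR : (tower n).mem A R) : R.HeadClosed := by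
  let S : CTS :=
    { mem := fun A R => (tower n).mem A R ∧ R.HeadClosed
      stable := fun f A R h => ⟨(tower n).stable f A R h.1, h.2.res f⟩ }
  have hS : S ≤ tower n := fun W A R h => h.1
  suffices tower n ≤ S from (this W A R hR).2
  refine (tsFun (spine n)).lfp_le fun W A R h => ⟨?_, ?_⟩
  · have := (tsFun (spine n)).monotone hS W A R h
    rwa [tower, tsClose, OrderHom.map_lfp] at this
  · rcases h with h | ⟨T, -, h⟩
    · obtain ⟨i, -, -, rfl⟩ := spine_mem.1 h
      rintro V f M M' N N' hM hN ⟨𝒜, h₀, h₁⟩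
      exact ⟨𝒜, tower_head hM h₀, tower_head hN h₁⟩
    · exact conns_headClosed (tower_agree n) hS (fun _ _ _ h => h.2) h

theorem omega_headClosed {W : World} {A : Pg W.card 0} {R : Rel W}
    (hR : omega.mem A R) : R.HeadClosed := by
  obtain ⟨n, hR⟩ := hR
  exact tower_headClosed n hR

end CTS
/-! ### Löb induction -/

/-- A stable proposition that is true later on `κ` is true at every world over `W` at which less time
is left on `κ`. -/
theorem Later.of_lt {W : World} {κ : Clk W} {φ : ∀ {V : World}, (V ⟶ W) → Prop}
    (hφ : ∀ {U V : World} (g : U ⟶ V) (f : V ⟶ W), φ f → φ (g ≫ f)) (h : Later κ φ) {V : World}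
    (f : V ⟶ W) (hf : V.time (f.fn κ) < W.time κ) : φ f := by
  obtain ⟨m, hm⟩ : ∃ m, W.time κ = m + 1 := Nat.exists_eq_succ_of_ne_zero (by omega)
  let f' : V ⟶ W.set κ m := ⟨f.fn, fun j => by
    by_cases hj : j = κ
    · rw [hj]; simp only [World.set, Function.update_self]; omega
    · rw [show (W.set κ m).time j = W.time j from Function.update_of_ne hj _ _]
      exact f.le_time j⟩
  exact hφ f' (tick κ m hm) (h m hm)

/-- Löb induction for membership in a relation. The induction step is needed only at those worlds
over `W` at which `κ` has ticked. -/
theorem Rel.loeb {W : World} {κ : Clk W} {𝒜 : Rel W} {M N : Pg W.card 0}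
    (h : ∀ (V : World) (f : V ⟶ W), V.time (f.fn κ) < W.time κ →
      (laterRel κ 𝒜).mem f (Pg.res f M) (Pg.res f N) → 𝒜.mem f (Pg.res f M) (Pg.res f N)) :
    (laterRel κ 𝒜).holds M N := by
  have key : ∀ (t : ℕ) (V : World) (f : V ⟶ W), V.time (f.fn κ) = t →
      (laterRel κ 𝒜).mem f (Pg.res f M) (Pg.res f N) := by
    intro t
    induction t with
    | zero => intro V f ht m hm; omega
    | succ t ih =>
      intro V f ht m hm
      obtain rfl : m = t := by omega
      have e : (V.set (f.fn κ) m).time ((tick _ m hm ≫ f).fn κ) = m := by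
        simp [World.set, tick]
      have := f.le_time κ
      have h₁ := h _ (tick _ m hm ≫ f) (by omega) (ih _ _ e)
      rwa [Pg.res_comp, Pg.res_comp] at h₁
  have := key _ W (𝟙 W) rfl
  rwa [Pg.res_id, Pg.res_id] at this

namespace CTS

/-! ### Function types and later modalities in the hierarchy -/

theorem tower_le_omega (n : ℕ) : tower n ≤ omega := fun _ _ _ h => ⟨n, h⟩

/-- A canonical type other than a universe belongs to the hierarchy by virtue of a connective. -/
theorem tower_conns {n : ℕ} {W : World} {A : Pg W.card 0} {R : Rel W} (hA : A.Val)
    (hu : ∀ i, A ≠ .univ i) (h : (tower n).mem A R) : (conns (tower n)).mem A R := by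
  rw [tower, tsClose_mem] at h
  rcases h with h | ⟨B, hB, h⟩
  · obtain ⟨i, -, hi, -⟩ := spine_mem.1 h
    exact absurd (hA.eval.det hi) (hu i)
  · rwa [← hA.eval.det hB] at h

theorem omega_pi {W : World} {A : Pg W.card 0} {B : Pg W.card 1} {R : Rel W}
    (h : omega.mem (.pi A B) R) : ∃ (𝒜 : Rel W) (ℬ : Fam W), omega.mem A 𝒜 ∧
      omega.Functional 𝒜 B ℬ ∧ R = Rel.piRel 𝒜 ℬ := by
  obtain ⟨n, h⟩ := h
  rcases tower_conns (.pi A B) (by simp) h with ⟨e, -⟩ | ⟨e, -⟩ | ⟨e, -⟩ | ⟨e, -⟩ |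
    ⟨_, _, _, _, e, -⟩ | ⟨_, _, 𝒜, ℬ, e, hA, hB, hR⟩ | ⟨_, _, e, -⟩ | ⟨_, _, _, _, e, -⟩ |
    ⟨_, _, _, e, -⟩ | ⟨_, _, e, -⟩ | ⟨_, _, _, _, e, -⟩ <;> cases e
  exact ⟨𝒜, ℬ, ⟨n, hA⟩, hB.mono (tower_le_omega n), hR⟩

theorem omega_later {W : World} {κ : Clk W} {A : Pg W.card 0} {R : Rel W}
    (h : omega.mem (.later κ A) R) : ∃ 𝒜 : Rel W,
      (Later κ fun {_} t => omega.mem (Pg.res t A) (𝒜.res t)) ∧ R = Rel.laterRel κ 𝒜 := by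
  obtain ⟨n, h⟩ := h
  rcases tower_conns (.later κ A) (by simp) h with ⟨e, -⟩ | ⟨e, -⟩ | ⟨e, -⟩ | ⟨e, -⟩ |
    ⟨_, _, _, _, e, -⟩ | ⟨_, _, _, _, e, -⟩ | ⟨_, _, e, -⟩ | ⟨_, _, _, _, e, -⟩ |
    ⟨_, _, 𝒜, e, hA, hR⟩ | ⟨_, _, e, -⟩ | ⟨_, _, _, _, e, -⟩ <;> cases e
  exact ⟨𝒜, fun m hm => ⟨n, hA m hm⟩, hR⟩

theorem omega_later_mem {W : World} (κ : Clk W) {A : Pg W.card 0} {𝒜 : Rel W}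
    (h : omega.mem A 𝒜) : omega.mem (.later κ A) (Rel.laterRel κ 𝒜) := by
  obtain ⟨n, h⟩ := h
  refine ⟨n, ?_⟩
  rw [tower, tsClose_mem]
  refine .inr ⟨_, (Pg.Val.later κ A).eval, ?_⟩
  exact .inr <| .inr <| .inr <| .inr <| .inr <| .inr <| .inr <| .inr <|
    .inl ⟨κ, A, 𝒜, rfl, fun m hm => (tower n).stable _ _ _ h, rfl⟩

theorem SimEnv.res {τ : CTS} {V W : World} (f : V ⟶ W) {n : ℕ} {Γ : Tl W.card n} :
    ∀ {γ₀ γ₁ : Fin n → Pg W.card 0}, τ.SimEnv Γ γ₀ γ₁ →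
      τ.SimEnv (Γ.res f) (Pg.res f ∘ γ₀) (Pg.res f ∘ γ₁) := by
  induction Γ with
  | nil => intros; trivial
  | snoc Γ A ih =>
    rintro γ₀ γ₁ ⟨h, 𝒜, hA, hM⟩
    refine ⟨ih h, 𝒜.res f, ?_, (Rel.holds_res _ _ _ _).2 (Rel.holds_stable f _ hM)⟩
    have := τ.stable f _ _ hA
    rwa [Pg.res_subst] at this

end CTS

theorem Tl.res_comp {U V W : World} (g : U ⟶ V) (f : V ⟶ W) {n : ℕ} (Γ : Tl W.card n) :
    Γ.res (g ≫ f) = (Γ.res f).res g := by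
  induction Γ with
  | nil => rfl
  | snoc Γ A ih => simp only [Tl.res, ih, Pg.res_comp]

/-! ### The fixed point rule -/

namespace CTS

/-- A type that is functional over `Γ` stays so over `Γ` extended by any variable. -/
theorem HypSimType.weaken {τ : CTS} {W : World} {n : ℕ} {Γ : Tl W.card n} {A B : Pg W.card n}
    (h : τ.HypSimType Γ A A) : τ.HypSimType (Γ.snoc B) (A.rename Fin.succ) (A.rename Fin.succ) := by
  rintro V f γ₀ γ₁ ⟨hγ, -⟩
  simp only [Pg.res, Pg.rename_mapClk, Pg.subst_rename]
  exact h V f _ _ hγ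

theorem HypSimType.later {W : World} {n : ℕ} {Γ : Tl W.card n} {A : Pg W.card n} (κ : Clk W)
    (h : omega.HypSimType Γ A A) : omega.HypSimType Γ (.later κ A) (.later κ A) := by
  intro V f γ₀ γ₁ hγ
  obtain ⟨𝒜, h₀, h₁⟩ := h V f γ₀ γ₁ hγ
  exact ⟨_, omega_later_mem (f.fn κ) h₀, omega_later_mem (f.fn κ) h₁⟩

/-- The fixed point rule, for programs. At similar `γ₀`, `γ₁` the fixed points are similar later, by
Löb induction on `κ`; hence the hypothesis applies to the environments extended by them, and its
conclusion is the one wanted, up to one unfolding of each fixed point. -/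
theorem hypSimMem_fix {W : World} {n : ℕ} {Γ : Tl W.card n} {A : Pg W.card n} {κ : Clk W}
    {M₀ M₁ : Pg W.card (n + 1)} (hA : omega.HypSimType Γ A A)
    (h : omega.HypSimMem (Γ.snoc (.later κ A)) M₀ M₁ (A.rename Fin.succ)) :
    omega.HypSimMem Γ (.fix M₀) (.fix M₁) A := by
  have step : ∀ (V : World) (f : V ⟶ W) (γ₀ γ₁ : Fin n → Pg V.card 0) (𝒜 : Rel V),
      omega.SimEnv (Γ.res f) γ₀ γ₁ → omega.mem ((Pg.res f A).subst γ₀) 𝒜 →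
      (Rel.laterRel (f.fn κ) 𝒜).holds ((Pg.res f (.fix M₀)).subst γ₀)
        ((Pg.res f (.fix M₁)).subst γ₁) →
      𝒜.holds ((Pg.res f (.fix M₀)).subst γ₀) ((Pg.res f (.fix M₁)).subst γ₁) := by
    intro V f γ₀ γ₁ 𝒜 hγ h𝒜 hF
    obtain ⟨𝒜', h𝒜', hM⟩ := h V f (ext γ₀ ((Pg.res f (.fix M₀)).subst γ₀))
      (ext γ₁ ((Pg.res f (.fix M₁)).subst γ₁)) ⟨hγ, _, omega_later_mem (f.fn κ) h𝒜, hF⟩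
    simp only [Pg.res, Pg.rename_mapClk, Pg.subst_rename] at h𝒜'
    obtain rfl := omega_agree h𝒜 h𝒜'
    rw [← Pg.inst_subst_up, ← Pg.inst_subst_up] at hM
    exact omega_headClosed h𝒜 _ (.single (.fix _)) (.single (.fix _)) hM
  intro V f γ₀ γ₁ hγ
  obtain ⟨𝒜, h𝒜, -⟩ := hA V f γ₀ γ₁ hγ
  refine ⟨𝒜, h𝒜, step V f γ₀ γ₁ 𝒜 hγ h𝒜 (Rel.loeb fun U g _ hF => ?_)⟩
  rw [← Rel.holds_res, Rel.laterRel_res] at hF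
  rw [← Rel.holds_res]
  simp only [Pg.res_subst, ← Pg.res_comp] at hF ⊢
  refine step U (g ≫ f) _ _ _ ?_ ?_ hF
  · rw [Tl.res_comp]; exact hγ.res g
  · have := omega.stable g _ _ h𝒜
    rwa [Pg.res_subst, ← Pg.res_comp] at this

/-! ### The fixed point combinator -/

/-- If `O` and `P` are similar functions of type `▷_κ A → A`, then their fixed points are similar at
the type `A`: the relation `𝒜` in the meaning of `▷_κ A` is a meaning of `A` after each tick of `κ`,
which is where Löb induction needs it. -/
theorem holds_fix_app {W : World} {κ : Clk W} {A : Pg W.card 0} {𝒟 ℛ : Rel W} {O P : Pg W.card 0}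
    (h𝒟 : omega.mem (.pi (.later κ A) (A.rename Fin.succ)) 𝒟) (hOP : 𝒟.holds O P)
    (hℛ : omega.mem A ℛ) :
    ℛ.holds (.fix (.app (O.rename Fin.succ) (.var 0)))
      (.fix (.app (P.rename Fin.succ) (.var 0))) := by
  have unfold : ∀ {c : ℕ} (O : Pg c 0), Pg.Step (.fix (.app (O.rename Fin.succ) (.var 0)))
      (.app O (.fix (.app (O.rename Fin.succ) (.var 0)))) := by
    intro c O
    have := Pg.Step.fix (.app (O.rename Fin.succ) (.var 0))
    rwa [Pg.inst, Pg.subst, ← Pg.inst, Pg.inst_weaken] at this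
  have res_fix : ∀ {V : World} (f : V ⟶ W) (O : Pg W.card 0),
      Pg.res f (.fix (.app (O.rename Fin.succ) (.var 0))) =
        .fix (.app ((Pg.res f O).rename Fin.succ) (.var 0)) := by
    intro V f O
    simp only [Pg.res, Pg.mapClk, Pg.rename_mapClk]
  obtain ⟨𝒜₁, ℬ, h𝒜₁, hℬ, rfl⟩ := omega_pi h𝒟
  obtain ⟨𝒜, hA, rfl⟩ := omega_later h𝒜₁
  -- If the fixed points are similar later, then they are similar in the fibre of `ℬ` over them.
  have step : ∀ (V : World) (f : V ⟶ W) (𝒮 : Rel V), omega.mem (Pg.res f A) 𝒮 →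
      (Rel.laterRel κ 𝒜).mem f (Pg.res f (.fix (.app (O.rename Fin.succ) (.var 0))))
        (Pg.res f (.fix (.app (P.rename Fin.succ) (.var 0)))) →
      𝒮.holds (Pg.res f (.fix (.app (O.rename Fin.succ) (.var 0))))
        (Pg.res f (.fix (.app (P.rename Fin.succ) (.var 0)))) := by
    intro V f 𝒮 h𝒮 hF
    have h₁ := (hℬ V f _ _ hF).1
    rw [Pg.res, Pg.rename_mapClk, Pg.inst_weaken] at h₁
    obtain rfl := omega_agree h𝒮 h₁
    have h₂ := hOP V f _ _ (by rwa [Category.comp_id])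
    rw [Category.comp_id] at h₂
    rw [res_fix f O] at h𝒮 h₂ ⊢
    rw [res_fix f P] at h₂ ⊢
    exact omega_headClosed h𝒮 _ (.single (unfold _)) (.single (unfold _)) h₂
  have hF := Rel.loeb (κ := κ) (𝒜 := 𝒜) fun V f hf hF =>
    (Rel.holds_res _ _ _ _).1 <| step V f (𝒜.res f)
      (Later.of_lt (φ := fun {_} t => omega.mem (Pg.res t A) (𝒜.res t)) (fun g f h => by
        rw [Pg.res_comp, Rel.res_comp]; exact omega.stable g _ _ h) hA f hf) hF
  have := step W (𝟙 W) ℛ (by rwa [Pg.res_id])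
  rw [Pg.res_id, Pg.res_id] at this
  exact this hF

/-- The formation of `A` over `Γ` is not assumed. At given arguments of the combinator it follows from
the functionality of its codomain over its domain. -/
theorem hypSimMem_fixComb {W : World} {n : ℕ} {Γ : Tl W.card n} {A : Pg W.card n} {κ : Clk W}
    (hT : omega.HypSimType Γ (.pi (.pi (.later κ A) (A.rename Fin.succ)) (A.rename Fin.succ))
      (.pi (.pi (.later κ A) (A.rename Fin.succ)) (A.rename Fin.succ))) :
    omega.HypSimMem Γ (.lam (.fix (.app (.var 1) (.var 0)))) (.lam (.fix (.app (.var 1) (.var 0))))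
      (.pi (.pi (.later κ A) (A.rename Fin.succ)) (A.rename Fin.succ)) := by
  intro V f γ₀ γ₁ hγ
  obtain ⟨R, hR, -⟩ := hT V f γ₀ γ₁ hγ
  refine ⟨R, hR, ?_⟩
  have weaken_up : ∀ A : Pg V.card n,
      (A.rename Fin.succ).subst (Pg.up γ₀) = (A.subst γ₀).rename Fin.succ := by
    intro A; rw [Pg.subst_rename, Pg.rename_subst]; rfl
  simp only [Pg.res, Pg.mapClk, Pg.subst, Pg.rename_mapClk, weaken_up] at hR
  obtain ⟨𝒟, ℬ, h𝒟, hℬ, rfl⟩ := omega_pi hR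
  intro U g O P hOP
  rw [Category.comp_id] at hOP ⊢
  have hB := (hℬ U g O P hOP).1
  refine omega_headClosed hB _ (.single (.app_lam _ _)) (.single (.app_lam _ _)) ?_
  rw [Pg.res, Pg.rename_mapClk, Pg.inst_weaken] at hB
  have h₁ := omega.stable g _ _ h𝒟
  simp only [Pg.res, Pg.mapClk, Pg.rename_mapClk] at h₁
  exact holds_fix_app h₁ ((Rel.holds_res _ _ _ _).2 hOP) hB

end CTS

end GCTT

theorem mainTheorem5 (Δ n : ℕ) (Γ : GCTT.Ctx (Δ + 1) n) (A : GCTT.Fm (Δ + 1) n) :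
    (∀ (M₀ M₁ : GCTT.Fm (Δ + 1) (n + 1)) (W : GCTT.World),
      GCTT.EqMem W (Γ.snoc (GCTT.Fm.later 0 A)) M₀ M₁ A.weaken →
      GCTT.EqMem W Γ (GCTT.Fm.fix M₀) (GCTT.Fm.fix M₁) A) ∧
    (∀ W : GCTT.World,
      GCTT.EqMem W Γ GCTT.Fm.fixComb GCTT.Fm.fixComb
        (GCTT.Fm.arrow (GCTT.Fm.arrow (GCTT.Fm.later 0 A) A) A)) := by
  constructor
  · intro M₀ M₁ W h V f ϱ hΓ hA
    have h₁ := h V f ϱ ⟨hΓ, hA.later (ϱ 0)⟩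
    rw [GCTT.Fm.weaken, GCTT.Fm.interp_rename] at h₁
    exact GCTT.CTS.hypSimMem_fix hA (h₁ hA.weaken)
  · intro W V f ϱ _ hT
    simp only [GCTT.Fm.arrow, GCTT.Fm.weaken, GCTT.Fm.interp, GCTT.Fm.interp_rename,
      GCTT.Fm.fixComb] at hT ⊢
    exact GCTT.CTS.hypSimMem_fixComb hT
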